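/- Let $N\ge 3$, let $\mathcal S_N=\{\eta\in[0,\infty)^N:\frac1N\sum_{j=1}^N\eta_j=1\}$, and let $\sigma_N$ be the uniform probability measure on $\mathcal S_N$ (the flat Dirichlet measure). For $f\in L^2(\mathcal S_N,\sigma_N)$ real-valued, let $\langle\cdot,\cdot\rangle$ and $\|\cdot\|_2$ be the inner product and norm of $L^2(\sigma_N)$. For $i<j$ and $\alpha\in[0,1]$ let $\eta^*_{i,j,\alpha}$ be the configuration obtained from $\eta$ by replacing $\eta_i$ by $(1-\alpha)(\eta_i+\eta_j)$ and $\eta_j$ by $\alpha(\eta_i+\eta_j)$, and put $[f]^{(i,j)}(\eta)=\int_0^1 f(\eta^*_{i,j,\alpha})\,d\alpha$. For $\gamma\in[0,1]$ let $$L_{\gamma,N}f(\eta)=-N\binom N2^{-1}\sum_{i<j}(\eta_i+\eta_j)^\gamma\bigl(f(\eta)-[f]^{(i,j)}(\eta)\bigr),\qquad \mathcal E_{\gamma,N}(f,f)=-\langle f,L_{\gamma,N}f\rangle ,$$ $$\mathcal G_{\gamma,N}(f,f)=\frac1N\sum_{k=1}^N\int_{\mathcal S_N}\Bigl(\frac{N-\eta_k}{N-1}\Bigr)^{\gamma}(f-P_kf)^2\,d\sigma_N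 ,$$ where $P_kf$ is the conditional expectation of $f$ given $\eta_k$ under $\sigma_N$. Let $\Delta_{\gamma,N}$ and $\Gamma_{\gamma,N}$ be the infima of $\mathcal E_{\gamma,N}(f,f)$ and $\mathcal G_{\gamma,N}(f,f)$, respectively, over all $f\in L^2(\mathcal S_N,\sigma_N)$ with $\|f\|_2=1$ and $\langle f,1\rangle=0$. Then for $\gamma=0$ and every $N\ge3$: $$\Gamma_{0,N}>0,\qquad \Gamma_{0,N}\ \ge\ 1-\frac1N-\frac2{N^2},\qquad \Delta_{0,N}\ \ge\ \frac23\,\frac{N+1}{N-1},$$ and the last bound is sharp, i.e. $\Delta_{0,N}=\frac23\,\frac{N+1}{N-1}$. In particular $\Delta_{0,N}$ is bounded below by a positive constant uniformly in $N\ge3$. -/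

import Mathlib

open MeasureTheory

noncomputable section

namespace StochasticExchange

/-- The state space of `N` particles with unit mean energy per particle: nonnegative energies
`η_1, …, η_N` with `(1/N) ∑ η_j = 1`. -/
def stateSpace (N : ℕ) : Set (Fin N → ℝ) :=
  {η | (∀ k, 0 ≤ η k) ∧ (1 / (N : ℝ)) * ∑ k, η k = 1}

/-- Affine parametrization of the hyperplane `∑ η_j = N` by its first `N - 1` coordinates. -/
def chart (N : ℕ) (x : Fin (N - 1) → ℝ) : Fin N → ℝ :=
  fun k => if h : (k : ℕ) < N - 1 then x ⟨k, h⟩ else (N : ℝ) - ∑ l, x l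

/-- The uniform probability measure (flat Dirichlet law) on the state space, regarded as a measure
on `ℝ^N` concentrated on the state space: in the coordinates `(η_1, …, η_{N-1})` it is Lebesgue
measure on the solid simplex, normalized to total mass one. -/
def sigma (N : ℕ) : Measure (Fin N → ℝ) :=
  (ProbabilityTheory.cond volume (chart N ⁻¹' stateSpace N)).map (chart N)

/-- The configuration after particles `i` and `j` have repartitioned their total energy: particle
`i` gets the fraction `1 - α` and particle `j` the fraction `α` of `η_i + η_j`. -/
def exchange {N : ℕ} (i j : Fin N) (α : ℝ) (η : Fin N → ℝ) : Fin N → ℝ :=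
  fun k => if k = i then (1 - α) * (η i + η j) else if k = j then α * (η i + η j) else η k

/-- `[f]^{(i,j)}`: the average of `f` over the outcome of a uniform exchange between `i`, `j`. -/
def pairAverage {N : ℕ} (i j : Fin N) (f : (Fin N → ℝ) → ℝ) (η : Fin N → ℝ) : ℝ :=
  ∫ α in (0 : ℝ)..1, f (exchange i j α η)

/-- The generator `L_{γ,N}`: each pair `i < j` collides at rate `N (N choose 2)⁻¹ (η_i + η_j)^γ`. -/
def generator (γ : ℝ) (N : ℕ) (f : (Fin N → ℝ) → ℝ) (η : Fin N → ℝ) : ℝ :=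
  -((N : ℝ) * ((N.choose 2 : ℕ) : ℝ)⁻¹ *
    ∑ i, ∑ j ∈ Finset.Ioi i, (η i + η j) ^ γ * (f η - pairAverage i j f η))

/-- The Dirichlet form `-⟨f, L_{γ,N} f⟩` in `L²` of the uniform measure. -/
def dirichletForm (γ : ℝ) (N : ℕ) (f : (Fin N → ℝ) → ℝ) : ℝ :=
  -∫ η, f η * generator γ N f η ∂(sigma N)

/-- `P_k f`, the conditional expectation of `f` given the energy `η_k`. -/
def proj {N : ℕ} (k : Fin N) (f : (Fin N → ℝ) → ℝ) : (Fin N → ℝ) → ℝ :=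
  condExp (MeasurableSpace.comap (fun η : Fin N → ℝ => η k) inferInstance) (sigma N) f

/-- The weight `w_N^{(γ)}(t) = ((N - t) / (N - 1))^γ`. -/
def weight (γ : ℝ) (N : ℕ) (t : ℝ) : ℝ :=
  (((N : ℝ) - t) / ((N : ℝ) - 1)) ^ γ

/-- The quadratic form `G_{γ,N}(f,f)`. -/
def reducedForm (γ : ℝ) (N : ℕ) (f : (Fin N → ℝ) → ℝ) : ℝ :=
  (1 / (N : ℝ)) * ∑ k, ∫ η, weight γ N (η k) * (f η - proj k f η) ^ 2 ∂(sigma N)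

/-- Admissible trial functions: `f ∈ L²`, `‖f‖₂ = 1`, `⟨f, 1⟩ = 0`. -/
def IsTrial (N : ℕ) (f : (Fin N → ℝ) → ℝ) : Prop :=
  MemLp f 2 (sigma N) ∧ ∫ η, f η ^ 2 ∂(sigma N) = 1 ∧ ∫ η, f η ∂(sigma N) = 0

/-- The spectral gap `Δ_{γ,N}` of the stochastic exchange model. -/
def Delta (γ : ℝ) (N : ℕ) : ℝ :=
  sInf {r | ∃ f, IsTrial N f ∧ dirichletForm γ N f = r}

/-- The spectral gap `Γ_{γ,N}` of the form `G_{γ,N}`. -/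
def Gam (γ : ℝ) (N : ℕ) : ℝ :=
  sInf {r | ∃ f, IsTrial N f ∧ reducedForm γ N f = r}

end StochasticExchange

end

/-! Two facts carry the theorem: a correlation inequality for functions of single coordinates, and
an induction on the number of particles that uses it without loss.

Correlation inequality (`integral_sq_sum_coord_le`): mean-zero functions of single coordinates
satisfy ‖∑ g_k(η_k)‖² ≤ (1 + 2/N) ∑ ‖g_k(η_k)‖². All correlations between distinct coordinates pass
through one self-adjoint operator K, the expectation of g(η_i) given η_j = t. Given η_j = t, the
other energies are again flat Dirichlet, rescaled, so K sends t^n to a constant times (N - t)^n.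
Hence K is triangular on monomials, with eigenvalues (-1)^n n!(N-2)!/(n+N-2)!. For n ≥ 1 they lie
between -1/(N-1) (n = 1) and 2/(N(N-1)) (n = 2). Splitting each g_k into the average over k and a
deviation gives the inequality. By duality ∑ ‖P_k f‖² ≤ (1 + 2/N)‖f‖² for mean-zero f, which is the
bound on Γ.

Induction (`variance_le_sum_pairForm`): the claim is (N+1)/3 · Var f ≤ ∑_{i<j} ⟨f, f - [f]^{(i,j)}⟩.
Freezing η_k leaves an (N-1)-particle system, and for γ = 0 rescaling it does not change the rates.
Each pair survives the freezing of N-2 coordinates, so N-2 times the pair sum is at least N/3 · ∑ ‖f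
- P_k f‖² ≥ N/3 · (N - 1 - 2/N) Var f = (N-2)(N+1)/3 · Var f. For N = 2 a single exchange
equilibrates the system and equality holds.

Sharpness (`generator_squareSum`): the centered sum of squares is an eigenfunction with exactly this
constant.

Identities between laws are proved by comparing moments, which determine a measure carried by a
compact set. -/

namespace StochasticExchange
open scoped Nat

/-! ### Dirichlet integrals and the moments of the flat Dirichlet law -/

theorem integral_pow_mul_sub_pow (s : ℝ) (a b : ℕ) :
    ∫ t in (0 : ℝ)..s, t ^ a * (s - t) ^ b =
      (a ! : ℝ) * b ! / (a + b + 1)! * s ^ (a + b + 1) := by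
  induction b generalizing a with
  | zero =>
    have h := Nat.factorial_ne_zero a
    simp only [pow_zero, mul_one, integral_pow, add_zero, Nat.factorial_zero, Nat.factorial_succ]
    push_cast
    field_simp
    simp
  | succ b ih =>
    have hu : ∀ t ∈ Set.uIcc 0 s, HasDerivAt (fun t : ℝ => (s - t) ^ (b + 1))
        (-((b + 1 : ℝ) * (s - t) ^ b)) t := by
      intro t _
      have := ((hasDerivAt_id t).const_sub s).pow (b + 1)
      convert! this using 1
      simp
    have hv : ∀ t ∈ Set.uIcc 0 s, HasDerivAt (fun t : ℝ => t ^ (a + 1) / (a + 1)) (t ^ a) t := by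
      intro t _
      have := (hasDerivAt_pow (a + 1) t).div_const ((a : ℝ) + 1)
      convert! this using 1
      have : (a : ℝ) + 1 ≠ 0 := by positivity
      push_cast
      field_simp
    have key := intervalIntegral.integral_mul_deriv_eq_deriv_mul hu hv
      (by apply Continuous.intervalIntegrable; fun_prop)
      (by apply Continuous.intervalIntegrable; fun_prop)
    have h1 : ∫ t in (0 : ℝ)..s, t ^ a * (s - t) ^ (b + 1) =
        (b + 1 : ℝ) / (a + 1) * ∫ t in (0 : ℝ)..s, t ^ (a + 1) * (s - t) ^ b := by
      rw [← intervalIntegral.integral_const_mul]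
      simp_rw [mul_comm (_ ^ a) _]
      rw [key]
      -- Both boundary terms vanish: at `s` through (s - t)^(b+1), at 0 through t^(a+1).
      simp only [sub_self, ne_eq, Nat.add_eq_zero_iff, one_ne_zero, and_false, not_false_eq_true,
        zero_pow, zero_mul, sub_zero, zero_div, mul_zero, zero_sub]
      rw [← intervalIntegral.integral_neg]
      congr 1
      ext t
      ring
    rw [h1, ih (a + 1)]
    rw [show a + 1 + b + 1 = a + (b + 1) + 1 by ring, Nat.factorial_succ a, Nat.factorial_succ b]
    push_cast
    have : (a : ℝ) + 1 ≠ 0 := by positivity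
    field_simp

theorem lintegral_pow_mul_sub_pow {s : ℝ} (hs : 0 ≤ s) (a b : ℕ) :
    ∫⁻ t in Set.Icc 0 s, ENNReal.ofReal (t ^ a * (s - t) ^ b) =
      ENNReal.ofReal ((a ! : ℝ) * b ! / (a + b + 1)! * s ^ (a + b + 1)) := by
  rw [← integral_pow_mul_sub_pow, intervalIntegral.integral_of_le hs,
    ← integral_Icc_eq_integral_Ioc, ofReal_integral_eq_lintegral_ofReal]
  · exact (by fun_prop : Continuous fun t : ℝ => t ^ a * (s - t) ^ b).integrableOn_Icc
  · filter_upwards [ae_restrict_mem measurableSet_Icc] with t ht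
    exact mul_nonneg (pow_nonneg ht.1 _) (pow_nonneg (sub_nonneg.2 ht.2) _)

/-- The solid simplex of nonnegative vectors with coordinate sum at most `s`. -/
def solidSimplex (M : ℕ) (s : ℝ) : Set (Fin M → ℝ) := {x | (∀ k, 0 ≤ x k) ∧ ∑ k, x k ≤ s}

theorem measurableSet_solidSimplex (M : ℕ) (s : ℝ) : MeasurableSet (solidSimplex M s) := by
  apply IsClosed.measurableSet
  apply IsClosed.inter
  · have : {x : Fin M → ℝ | ∀ k, 0 ≤ x k} = ⋂ k, {x | 0 ≤ x k} := by ext; simp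
    change IsClosed {x : Fin M → ℝ | ∀ k, 0 ≤ x k}
    rw [this]
    exact isClosed_iInter fun k => isClosed_le continuous_const (continuous_apply k)
  · exact isClosed_le (by fun_prop : Continuous fun x : Fin M → ℝ => ∑ k, x k) continuous_const

theorem cons_mem_solidSimplex {M : ℕ} {s t : ℝ} {y : Fin M → ℝ} :
    Fin.cons t y ∈ solidSimplex (M + 1) s ↔ t ∈ Set.Icc 0 s ∧ y ∈ solidSimplex M (s - t) := by
  simp only [solidSimplex, Set.mem_ofPred_eq, Fin.forall_fin_succ, Fin.cons_zero, Fin.cons_succ,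
    Fin.sum_univ_succ, Set.mem_Icc]
  constructor
  · rintro ⟨⟨h0, h1⟩, h2⟩
    have := Finset.sum_nonneg fun k (_ : k ∈ Finset.univ) => h1 k
    exact ⟨⟨h0, by linarith⟩, h1, by linarith⟩
  · rintro ⟨⟨h0, h1⟩, h2, h3⟩
    exact ⟨⟨h0, h2⟩, by linarith⟩

/-- Slicing at a first coordinate `t` leaves a solid simplex of size `s - t`, so the induction must
run over all `s`; integrating over `t` is then a Beta integral. The exponent `b` of the slack is
reserved for the last energy, which `chart` expresses as the slack. -/
theorem lintegral_solidSimplex (M : ℕ) (a : Fin M → ℕ) (b : ℕ) {s : ℝ} (hs : 0 ≤ s) :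
    ∫⁻ x in solidSimplex M s, ENNReal.ofReal ((∏ k, x k ^ a k) * (s - ∑ k, x k) ^ b) =
      ENNReal.ofReal ((∏ k, ((a k)! : ℝ)) * b ! / (∑ k, a k + b + M)! *
        s ^ (∑ k, a k + b + M)) := by
  induction M generalizing s with
  | zero =>
    have h1 : solidSimplex 0 s = Set.univ := by
      ext x; simp [solidSimplex, hs]
    have h2 : (b ! : ℝ) ≠ 0 := by exact_mod_cast b.factorial_ne_zero
    rw [h1, Measure.restrict_univ, Measure.volume_pi_eq_dirac 0, lintegral_dirac]
    simp [h2]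
  | succ M ih =>
    have hm := measurableSet_solidSimplex (M + 1) s
    have hmp := (volume_preserving_piFinSuccAbove (fun _ : Fin (M + 1) => ℝ) 0).symm
    rw [← lintegral_indicator hm, ← hmp.lintegral_comp_emb (MeasurableEquiv.measurableEmbedding _)]
    rw [Measure.volume_eq_prod, lintegral_prod _ (Measurable.aemeasurable ?_)]
    · have : ∀ t : ℝ, ∫⁻ y : Fin M → ℝ, (solidSimplex (M + 1) s).indicator
          (fun x => ENNReal.ofReal ((∏ k, x k ^ a k) * (s - ∑ k, x k) ^ b))
          ((MeasurableEquiv.piFinSuccAbove (fun _ : Fin (M + 1) => ℝ) 0).symm (t, y)) =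
          (Set.Icc 0 s).indicator (fun t => ENNReal.ofReal
            ((∏ k : Fin M, ((a k.succ)! : ℝ)) * b ! / (∑ k : Fin M, a k.succ + b + M)!) *
            ENNReal.ofReal (t ^ a 0 * (s - t) ^ (∑ k : Fin M, a k.succ + b + M))) t := by
        intro t
        have hcons : ∀ y : Fin M → ℝ, (MeasurableEquiv.piFinSuccAbove
            (fun _ : Fin (M + 1) => ℝ) 0).symm (t, y) = Fin.cons t y := by
          intro y
          simp [MeasurableEquiv.piFinSuccAbove, Fin.insertNthEquiv]
        simp_rw [hcons]
        by_cases ht : t ∈ Set.Icc 0 s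
        · rw [Set.indicator_of_mem ht]
          have : ∀ y : Fin M → ℝ, (solidSimplex (M + 1) s).indicator
            (fun x => ENNReal.ofReal ((∏ k, x k ^ a k) * (s - ∑ k, x k) ^ b)) (Fin.cons t y) =
            ENNReal.ofReal (t ^ a 0) * (solidSimplex M (s - t)).indicator
            (fun x => ENNReal.ofReal ((∏ k, x k ^ a k.succ) * (s - t - ∑ k, x k) ^ b)) y := by
            intro y
            by_cases hy : y ∈ solidSimplex M (s - t)
            · rw [Set.indicator_of_mem hy, Set.indicator_of_mem (cons_mem_solidSimplex.2 ⟨ht, hy⟩),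
                ← ENNReal.ofReal_mul (pow_nonneg ht.1 _)]
              congr 1
              simp only [Fin.prod_univ_succ, Fin.cons_zero, Fin.cons_succ, Fin.sum_univ_succ]
              ring
            · rw [Set.indicator_of_notMem hy, Set.indicator_of_notMem, mul_zero]
              exact fun h => hy (cons_mem_solidSimplex.1 h).2
          simp_rw [this]
          rw [lintegral_const_mul, lintegral_indicator (measurableSet_solidSimplex _ _),
            ih _ (sub_nonneg.2 ht.2), ← ENNReal.ofReal_mul (pow_nonneg ht.1 _),
            ← ENNReal.ofReal_mul]
          · congr 1; ring
          · positivity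
          · exact Measurable.indicator (by fun_prop) (measurableSet_solidSimplex _ _)
        · rw [Set.indicator_of_notMem ht]
          simp_rw [Set.indicator_of_notMem fun h => ht (cons_mem_solidSimplex.1 h).1]
          simp
      simp_rw [this]
      rw [lintegral_indicator measurableSet_Icc, lintegral_const_mul _ (by fun_prop),
        lintegral_pow_mul_sub_pow hs, ← ENNReal.ofReal_mul (by positivity)]
      congr 1
      rw [Fin.prod_univ_succ, Fin.sum_univ_succ,
        show a 0 + (∑ k : Fin M, a k.succ + b + M) + 1 =
          a 0 + ∑ k : Fin M, a k.succ + b + (M + 1) by ring]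
      have h2 : ((∑ k : Fin M, a k.succ + b + M)! : ℝ) ≠ 0 := by
        exact_mod_cast Nat.factorial_ne_zero _
      field_simp
    · exact (Measurable.indicator (by fun_prop) hm).comp (MeasurableEquiv.measurable _)

theorem chart_preimage_stateSpace (M : ℕ) :
    chart (M + 1) ⁻¹' stateSpace (M + 1) = solidSimplex M ((M + 1 : ℕ) : ℝ) := by
  ext x
  have h : ((M + 1 : ℕ) : ℝ) ≠ 0 := by positivity
  have hs : ∑ k, chart (M + 1) x k = ((M + 1 : ℕ) : ℝ) := by
    rw [Fin.sum_univ_castSucc]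
    simp [chart]
  simp only [Set.mem_preimage, stateSpace, Set.mem_ofPred_eq, hs, solidSimplex]
  rw [Fin.forall_fin_succ']
  rw [one_div_mul_cancel h]
  simp [chart]

theorem measurable_chart (N : ℕ) : Measurable (chart N) := by
  apply measurable_pi_lambda
  intro k
  unfold chart
  split_ifs <;> fun_prop

theorem volume_solidSimplex (M : ℕ) {s : ℝ} (hs : 0 ≤ s) :
    volume (solidSimplex M s) = ENNReal.ofReal (s ^ M / M !) := by
  have := lintegral_solidSimplex M (fun _ => 0) 0 hs
  simp only [pow_zero, Finset.prod_const_one, mul_one, ENNReal.ofReal_one, setLIntegral_const,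
    one_mul, Nat.factorial_zero, Nat.cast_one, Finset.sum_const_zero, zero_add] at this
  rw [this]
  congr 1; ring

instance isProbabilityMeasure_sigma (M : ℕ) : IsProbabilityMeasure (sigma (M + 1)) := by
  unfold sigma
  rw [chart_preimage_stateSpace]
  have hv := volume_solidSimplex M (s := ((M + 1 : ℕ) : ℝ)) (by positivity)
  have : IsProbabilityMeasure
      (ProbabilityTheory.cond volume (solidSimplex M ((M + 1 : ℕ) : ℝ))) := by
    apply ProbabilityTheory.cond_isProbabilityMeasure_of_finite
    · rw [hv]
      have : (0:ℝ) < ((M + 1 : ℕ) : ℝ) ^ M / M ! := by positivity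
      simpa using this
    · rw [hv]; exact ENNReal.ofReal_ne_top
  exact Measure.isProbabilityMeasure_map (measurable_chart _).aemeasurable

theorem ae_mem_stateSpace (M : ℕ) : ∀ᵐ η ∂sigma (M + 1), η ∈ stateSpace (M + 1) := by
  unfold sigma
  have hm : MeasurableSet (stateSpace (M + 1)) := by
    unfold stateSpace
    measurability
  refine (ae_map_iff (p := (· ∈ stateSpace (M + 1))) (measurable_chart _).aemeasurable hm).2 ?_
  apply Measure.ae_smul_measure
  exact ae_restrict_mem (measurable_chart _ hm)

theorem integral_prod_pow_sigma (M : ℕ) (a : Fin (M + 1) → ℕ) :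
    ∫ η, ∏ k, η k ^ a k ∂sigma (M + 1) =
      (∏ k, ((a k)! : ℝ)) * M ! / (∑ k, a k + M)! * (M + 1 : ℝ) ^ (∑ k, a k) := by
  have hT : (0 : ℝ) ≤ ((M + 1 : ℕ) : ℝ) := by positivity
  have hnn : 0 ≤ᵐ[sigma (M + 1)] fun η => ∏ k, η k ^ a k := by
    filter_upwards [ae_mem_stateSpace M] with η hη
    exact Finset.prod_nonneg fun k _ => pow_nonneg (hη.1 k) _
  rw [integral_eq_lintegral_of_nonneg_ae hnn (by
    apply Measurable.aestronglyMeasurable; fun_prop)]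
  unfold sigma
  rw [lintegral_map (by fun_prop) (measurable_chart _), chart_preimage_stateSpace,
    ProbabilityTheory.cond, lintegral_smul_measure]
  have h1 : ∀ x : Fin M → ℝ, ∏ k, chart (M + 1) x k ^ a k =
      (∏ k : Fin M, x k ^ a k.castSucc) *
        (((M + 1 : ℕ) : ℝ) - ∑ k, x k) ^ a (Fin.last M) := by
    intro x
    rw [Fin.prod_univ_castSucc]
    simp [chart]
  have h2 := lintegral_solidSimplex M (fun k => a k.castSucc) (a (Fin.last M)) hT
  simp_rw [← h1] at h2
  change ENNReal.toReal ((volume (solidSimplex M ((M + 1 : ℕ) : ℝ)))⁻¹ *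
    ∫⁻ x in solidSimplex M ((M + 1 : ℕ) : ℝ), _) = _
  rw [h2, volume_solidSimplex M hT, ENNReal.toReal_mul, ENNReal.toReal_inv,
    ENNReal.toReal_ofReal (by positivity), ENNReal.toReal_ofReal (by positivity),
    Fin.prod_univ_castSucc, Fin.sum_univ_castSucc, pow_add _ _ M]
  have h3 : (((M + 1 : ℕ) : ℝ)) ^ M ≠ 0 := by positivity
  push_cast at h3 ⊢
  field_simp

end StochasticExchange

/-! ### Moments determine compactly supported measures; invariance under exchange -/

namespace StochasticExchange
open scoped Nat

theorem exists_mvPolynomial_near {ι : Type*} [Finite ι] {K : Set (ι → ℝ)} (hK : IsCompact K)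
    {f : (ι → ℝ) → ℝ} (hf : Continuous f) {ε : ℝ} (hε : 0 < ε) :
    ∃ p : MvPolynomial ι ℝ, ∀ x ∈ K, ‖MvPolynomial.eval x p - f x‖ < ε := by
  let c : ι → C(ι → ℝ, ℝ) := fun i => ⟨fun x => x i, continuous_apply i⟩
  have hsep : (Algebra.adjoin ℝ (Set.range c)).SeparatesPoints := by
    intro x y hxy
    obtain ⟨i, hi⟩ := Function.ne_iff.1 hxy
    exact ⟨c i, ⟨c i, Algebra.subset_adjoin ⟨i, rfl⟩, rfl⟩, hi⟩
  obtain ⟨g, hg, h⟩ :=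
    ContinuousMap.exists_mem_subalgebra_near_continuous_of_isCompact_of_separatesPoints
      hsep ⟨f, hf⟩ hK hε
  rw [Algebra.adjoin_range_eq_range_aeval] at hg
  obtain ⟨p, rfl⟩ := hg
  refine ⟨p, fun x hx => ?_⟩
  have : (MvPolynomial.aeval c p) x = MvPolynomial.eval x p := by
    have h1 : (ContinuousMap.evalAlgHom ℝ ℝ x).comp (MvPolynomial.aeval c) =
        MvPolynomial.aeval x := by
      apply MvPolynomial.algHom_ext
      intro i
      simp [c, ContinuousMap.evalAlgHom]
      rfl
    exact DFunLike.congr_fun h1 p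
  rw [← this]
  exact h x hx

theorem memLp_top_of_continuous_of_ae_mem {X : Type*} [TopologicalSpace X] [MeasurableSpace X]
    [BorelSpace X] {μ : Measure X} {K : Set X} (hK : IsCompact K)
    (hμ : ∀ᵐ x ∂μ, x ∈ K) {f : X → ℝ} (hf : Continuous f) : MemLp f ⊤ μ := by
  obtain ⟨C, hC⟩ := hK.exists_bound_of_continuousOn hf.continuousOn
  refine memLp_top_of_bound hf.measurable.aestronglyMeasurable C ?_
  filter_upwards [hμ] with x hx using hC x hx

theorem integrable_of_continuous_of_ae_mem {X : Type*} [TopologicalSpace X] [MeasurableSpace X]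
    [BorelSpace X] {μ : Measure X} [IsFiniteMeasure μ] {K : Set X} (hK : IsCompact K)
    (hμ : ∀ᵐ x ∂μ, x ∈ K) {f : X → ℝ} (hf : Continuous f) : Integrable f μ :=
  (memLp_top_of_continuous_of_ae_mem hK hμ hf).integrable le_top

/-- Polynomials are uniformly dense in the continuous functions on a compact set, and integrals of
bounded continuous functions determine a finite measure. -/
theorem ext_of_integral_monomial {ι : Type*} [Fintype ι] {μ ν : Measure (ι → ℝ)}
    [IsFiniteMeasure μ] [IsFiniteMeasure ν] {K : Set (ι → ℝ)} (hK : IsCompact K)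
    (hμ : ∀ᵐ x ∂μ, x ∈ K) (hν : ∀ᵐ x ∂ν, x ∈ K)
    (h : ∀ a : ι → ℕ, ∫ x, ∏ k, x k ^ a k ∂μ = ∫ x, ∏ k, x k ^ a k ∂ν) : μ = ν := by
  have hpoly : ∀ p : MvPolynomial ι ℝ,
      ∫ x, MvPolynomial.eval x p ∂μ = ∫ x, MvPolynomial.eval x p ∂ν := by
    intro p
    simp_rw [MvPolynomial.eval_eq']
    rw [integral_finsetSum _ fun d _ => ?_, integral_finsetSum _ fun d _ => ?_]
    · simp_rw [integral_const_mul, h]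
    · exact integrable_of_continuous_of_ae_mem hK hν (by fun_prop)
    · exact integrable_of_continuous_of_ae_mem hK hμ (by fun_prop)
  apply ext_of_forall_integral_eq_of_IsFiniteMeasure
  intro f
  refine eq_of_forall_dist_le fun ε hε => ?_
  obtain ⟨δ, hδ, hδε⟩ : ∃ δ > 0, δ * (μ.real Set.univ + ν.real Set.univ) ≤ ε := by
    have h0 : 0 ≤ μ.real Set.univ + ν.real Set.univ := by positivity
    -- The added 1 keeps the denominator positive when both masses vanish.
    refine ⟨ε / (μ.real Set.univ + ν.real Set.univ + 1), by positivity, ?_⟩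
    rw [div_mul_eq_mul_div, div_le_iff₀ (by positivity)]
    nlinarith
  obtain ⟨p, hp⟩ := exists_mvPolynomial_near hK f.continuous hδ
  have bound : ∀ (ρ : Measure (ι → ℝ)) [IsFiniteMeasure ρ], (∀ᵐ x ∂ρ, x ∈ K) →
      ‖∫ x, MvPolynomial.eval x p ∂ρ - ∫ x, f x ∂ρ‖ ≤ δ * ρ.real Set.univ := by
    intro ρ _ hρ
    rw [← integral_sub]
    · apply norm_integral_le_of_norm_le_const
      filter_upwards [hρ] with x hx using (hp x hx).le
    · exact integrable_of_continuous_of_ae_mem hK hρ (MvPolynomial.continuous_eval p)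
    · exact integrable_of_continuous_of_ae_mem hK hρ f.continuous
  have h1 := bound μ hμ
  have h2 := bound ν hν
  rw [hpoly p, norm_sub_rev] at h1
  rw [Real.dist_eq]
  calc |∫ x, f x ∂μ - ∫ x, f x ∂ν|
      = ‖(∫ x, f x ∂μ - ∫ x, MvPolynomial.eval x p ∂ν) +
          (∫ x, MvPolynomial.eval x p ∂ν - ∫ x, f x ∂ν)‖ := by
        rw [Real.norm_eq_abs]; congr 1; ring
    _ ≤ _ := (norm_add_le _ _).trans (add_le_add h1 h2)
    _ ≤ ε := by linarith

/-- A box containing the state space. -/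
def box (N : ℕ) : Set (Fin N → ℝ) := Set.Icc 0 (fun _ => (N : ℝ))

theorem isCompact_box (N : ℕ) : IsCompact (box N) := isCompact_Icc

theorem sum_eq_of_mem_stateSpace {N : ℕ} {η : Fin N → ℝ} (h : η ∈ stateSpace N) :
    ∑ k, η k = N := by
  have := h.2
  rcases eq_or_ne (N : ℝ) 0 with h0 | h0
  · simp [h0] at this
  · field_simp at this
    exact this

theorem mem_stateSpace_of_sum_eq {M : ℕ} {η : Fin (M + 1) → ℝ} (h : ∀ k, 0 ≤ η k)
    (hs : ∑ k, η k = M + 1) : η ∈ stateSpace (M + 1) := by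
  refine ⟨h, ?_⟩
  rw [hs]
  have : (M : ℝ) + 1 ≠ 0 := by positivity
  push_cast
  field_simp

theorem stateSpace_subset_box (N : ℕ) : stateSpace N ⊆ box N := by
  intro η hη
  refine ⟨hη.1, fun k => ?_⟩
  rw [← sum_eq_of_mem_stateSpace hη]
  exact Finset.single_le_sum (fun k _ => hη.1 k) (Finset.mem_univ k)

theorem ae_mem_box (M : ℕ) : ∀ᵐ η ∂sigma (M + 1), η ∈ box (M + 1) :=
  (ae_mem_stateSpace M).mono fun _ h => stateSpace_subset_box _ h

theorem memLp_of_continuous {M : ℕ} {f : (Fin (M + 1) → ℝ) → ℝ} (hf : Continuous f)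
    (p : ENNReal) : MemLp f p (sigma (M + 1)) :=
  (memLp_top_of_continuous_of_ae_mem (isCompact_box _) (ae_mem_box M) hf).mono_exponent le_top

theorem integrable_of_continuous {M : ℕ} {f : (Fin (M + 1) → ℝ) → ℝ} (hf : Continuous f) :
    Integrable f (sigma (M + 1)) :=
  (memLp_of_continuous hf 1).integrable le_rfl

/-- The law of the exchange fraction. -/
noncomputable def unif : Measure ℝ := volume.restrict (Set.Ioc 0 1)

instance : IsProbabilityMeasure unif := ⟨by simp [unif]⟩

theorem pairAverage_eq {N : ℕ} (i j : Fin N) (f : (Fin N → ℝ) → ℝ) (η : Fin N → ℝ) :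
    pairAverage i j f η = ∫ α, f (exchange i j α η) ∂unif := by
  rw [pairAverage, intervalIntegral.integral_of_le zero_le_one, unif]

theorem continuous_exchange {N : ℕ} (i j : Fin N) :
    Continuous fun p : (Fin N → ℝ) × ℝ => exchange i j p.2 p.1 := by
  apply continuous_pi
  intro k
  unfold exchange
  split_ifs <;> fun_prop

theorem prod_eq_mul_mul_prod_erase {N : ℕ} {i j : Fin N} (hij : i ≠ j) {R : Type*} [CommMonoid R]
    (F : Fin N → R) : ∏ k, F k = F i * F j * ∏ k ∈ (Finset.univ.erase i).erase j, F k := by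
  rw [mul_assoc, Finset.mul_prod_erase _ F (by simp [hij.symm]),
    Finset.mul_prod_erase _ F (Finset.mem_univ i)]

theorem sum_eq_add_add_sum_erase {N : ℕ} {i j : Fin N} (hij : i ≠ j) {R : Type*}
    [AddCommMonoid R] (F : Fin N → R) :
    ∑ k, F k = F i + F j + ∑ k ∈ (Finset.univ.erase i).erase j, F k := by
  rw [add_assoc, Finset.add_sum_erase _ F (by simp [hij.symm]),
    Finset.add_sum_erase _ F (Finset.mem_univ i)]

section exchange

variable {N : ℕ} {i j : Fin N} (α : ℝ) (η : Fin N → ℝ)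

theorem exchange_left : exchange i j α η i = (1 - α) * (η i + η j) := by simp [exchange]

theorem exchange_right (hij : i ≠ j) : exchange i j α η j = α * (η i + η j) := by
  simp [exchange, hij.symm]

theorem exchange_of_mem {k : Fin N} (hk : k ∈ (Finset.univ.erase i).erase j) :
    exchange i j α η k = η k := by
  simp only [Finset.mem_erase, Finset.mem_univ, and_true] at hk
  simp [exchange, hk.1, hk.2]

end exchange

theorem exchange_mem_stateSpace {N : ℕ} {i j : Fin N} (hij : i ≠ j) {α : ℝ}
    (hα : α ∈ Set.Icc (0 : ℝ) 1) {η : Fin N → ℝ} (h : η ∈ stateSpace N) :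
    exchange i j α η ∈ stateSpace N := by
  have hs := add_nonneg (h.1 i) (h.1 j)
  constructor
  · intro k
    unfold exchange
    split_ifs
    · exact mul_nonneg (sub_nonneg.2 hα.2) hs
    · exact mul_nonneg hα.1 hs
    · exact h.1 k
  · refine Eq.trans ?_ h.2
    rw [sum_eq_add_add_sum_erase hij (exchange i j α η), sum_eq_add_add_sum_erase hij η, exchange_left,
      exchange_right α η hij, Finset.sum_congr rfl fun k hk => exchange_of_mem α η hk]
    ring

theorem integral_pow_mul_pow_unif (a b : ℕ) :
    ∫ α, (1 - α) ^ a * α ^ b ∂unif = (a ! : ℝ) * b ! / (a + b + 1)! := by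
  have h := integral_pow_mul_sub_pow 1 b a
  rw [intervalIntegral.integral_of_le zero_le_one] at h
  rw [one_pow, mul_one, mul_comm (b ! : ℝ), add_comm b a] at h
  rw [← h, unif]
  simp_rw [mul_comm]

/-- In the binomial expansion of (η_i + η_j)^n the coefficient cancels the factorials m!(n-m)! of
the moment. All n + 1 terms are therefore equal, and their sum produces (n + 1)!. -/
theorem integral_add_pow_mul_prod_sigma {M : ℕ} {i j : Fin (M + 1)} (hij : i ≠ j)
    (a : Fin (M + 1) → ℕ) :
    ∫ η, (η i + η j) ^ (a i + a j) * ∏ k ∈ (Finset.univ.erase i).erase j, η k ^ a k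
      ∂sigma (M + 1) = (a i + a j + 1)! * (∏ k ∈ (Finset.univ.erase i).erase j, ((a k)! : ℝ)) *
        M ! / (∑ k, a k + M)! * (M + 1 : ℝ) ^ (∑ k, a k) := by
  set n := a i + a j with hn
  let b : ℕ → Fin (M + 1) → ℕ := fun m => Function.update (Function.update a i m) j (n - m)
  have hbi : ∀ m, b m i = m := fun m => by simp [b, hij]
  have hbj : ∀ m, b m j = n - m := fun m => by simp [b]
  have hbk : ∀ m, ∀ k ∈ (Finset.univ.erase i).erase j, b m k = a k := fun m k hk => by
    simp only [Finset.mem_erase, Finset.mem_univ, and_true] at hk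
    simp [b, hk.1, hk.2]
  have h1 : ∀ η : Fin (M + 1) → ℝ, (η i + η j) ^ n *
      ∏ k ∈ (Finset.univ.erase i).erase j, η k ^ a k =
      ∑ m ∈ Finset.range (n + 1), (n.choose m : ℝ) * ∏ k, η k ^ b m k := by
    intro η
    rw [add_pow, Finset.sum_mul]
    refine Finset.sum_congr rfl fun m _ => ?_
    rw [prod_eq_mul_mul_prod_erase hij, hbi, hbj,
      Finset.prod_congr rfl fun k hk => congrArg (η k ^ ·) (hbk m k hk)]
    ring
  simp_rw [h1]
  rw [integral_finsetSum _ fun m _ => integrable_of_continuous (by fun_prop)]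
  simp_rw [integral_const_mul, integral_prod_pow_sigma]
  have h2 : ∀ m ∈ Finset.range (n + 1), (n.choose m : ℝ) * ((∏ k, ((b m k)! : ℝ)) * M ! /
      (∑ k, b m k + M)! * (M + 1 : ℝ) ^ (∑ k, b m k)) =
      n ! * (∏ k ∈ (Finset.univ.erase i).erase j, ((a k)! : ℝ)) *
        M ! / (∑ k, a k + M)! * (M + 1 : ℝ) ^ (∑ k, a k) := by
    intro m hm
    have hmn : m ≤ n := Nat.lt_succ_iff.1 (Finset.mem_range.1 hm)
    have hs : ∑ k, b m k = ∑ k, a k := by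
      rw [sum_eq_add_add_sum_erase hij, sum_eq_add_add_sum_erase hij a, hbi, hbj,
        Finset.sum_congr rfl (hbk m), Nat.add_sub_cancel' hmn]
    rw [hs, prod_eq_mul_mul_prod_erase hij, hbi, hbj,
      Finset.prod_congr rfl fun k hk => by rw [hbk m k hk], ← Nat.choose_mul_factorial_mul_factorial hmn]
    push_cast
    ring
  rw [Finset.sum_congr rfl h2, Finset.sum_const, Finset.card_range, nsmul_eq_mul,
    Nat.factorial_succ]
  push_cast
  ring

/-- Moments after the exchange factor into a moment of the pair energy and a Beta integral in the
fraction; the factor (a_i + a_j + 1)! cancels between them, leaving the original moment. -/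
theorem measurePreserving_exchange {M : ℕ} {i j : Fin (M + 1)} (hij : i ≠ j) :
    MeasurePreserving (fun p : (Fin (M + 1) → ℝ) × ℝ => exchange i j p.2 p.1)
      ((sigma (M + 1)).prod unif) (sigma (M + 1)) := by
  have hc := continuous_exchange i j
  refine ⟨hc.measurable, ?_⟩
  have hK : ∀ᵐ p ∂(sigma (M + 1)).prod unif, exchange i j p.2 p.1 ∈ stateSpace (M + 1) := by
    have h1 : ∀ᵐ p ∂(sigma (M + 1)).prod unif, p.1 ∈ stateSpace (M + 1) :=
      Measure.quasiMeasurePreserving_fst.ae (ae_mem_stateSpace M)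
    have h2 : ∀ᵐ p ∂(sigma (M + 1)).prod unif, p.2 ∈ Set.Ioc (0 : ℝ) 1 :=
      Measure.quasiMeasurePreserving_snd.ae (ae_restrict_mem measurableSet_Ioc)
    filter_upwards [h1, h2] with p hp1 hp2
    exact exchange_mem_stateSpace hij ⟨hp2.1.le, hp2.2⟩ hp1
  have : IsProbabilityMeasure (Measure.map (fun p : (Fin (M + 1) → ℝ) × ℝ => exchange i j p.2 p.1)
      ((sigma (M + 1)).prod unif)) := Measure.isProbabilityMeasure_map hc.aemeasurable
  refine ext_of_integral_monomial (isCompact_box _) ?_ (ae_mem_box M) fun a => ?_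
  · refine (ae_map_iff (p := (· ∈ box (M + 1))) hc.aemeasurable
      (isCompact_box _).measurableSet).2 ?_
    exact hK.mono fun _ h => stateSpace_subset_box _ h
  · rw [integral_map hc.aemeasurable (Continuous.aestronglyMeasurable (by fun_prop))]
    have h1 : ∀ p : (Fin (M + 1) → ℝ) × ℝ, ∏ k, exchange i j p.2 p.1 k ^ a k =
        ((p.1 i + p.1 j) ^ (a i + a j) * ∏ k ∈ (Finset.univ.erase i).erase j, p.1 k ^ a k) *
          ((1 - p.2) ^ a i * p.2 ^ a j) := by
      intro p
      rw [prod_eq_mul_mul_prod_erase hij, exchange_left, exchange_right _ _ hij,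
        Finset.prod_congr rfl fun k hk => by rw [exchange_of_mem _ _ hk], mul_pow, mul_pow]
      ring
    simp_rw [h1]
    rw [integral_prod_mul (fun η : Fin (M + 1) → ℝ => (η i + η j) ^ (a i + a j) *
      ∏ k ∈ (Finset.univ.erase i).erase j, η k ^ a k) (fun α : ℝ => (1 - α) ^ a i * α ^ a j),
      integral_add_pow_mul_prod_sigma hij, integral_pow_mul_pow_unif, integral_prod_pow_sigma,
      prod_eq_mul_mul_prod_erase hij]
    have := Nat.factorial_ne_zero (a i + a j + 1)
    field_simp

end StochasticExchange

/-! ### Disintegration along one coordinate -/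

namespace StochasticExchange
open scoped Nat

/-- The law of a single coordinate under `sigma (M + 2)`. -/
noncomputable def marginal (M : ℕ) : Measure ℝ :=
  (volume.restrict (Set.Icc 0 (M + 2 : ℝ))).withDensity
    fun t => ENNReal.ofReal ((M + 1) / (M + 2) ^ (M + 1) * (M + 2 - t) ^ M)

/-- The configuration with value `p.1` at `k` whose other coordinates are a rescaling of `p.2`. -/
noncomputable def splice {M : ℕ} (k : Fin (M + 2)) (p : ℝ × (Fin (M + 1) → ℝ)) : Fin (M + 2) → ℝ :=
  k.insertNth (α := fun _ => ℝ) p.1 fun l => (M + 2 - p.1) / (M + 1) * p.2 l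

@[simp]
theorem splice_same {M : ℕ} (k : Fin (M + 2)) (p : ℝ × (Fin (M + 1) → ℝ)) :
    splice k p k = p.1 := by simp [splice]

@[simp]
theorem splice_succAbove {M : ℕ} (k : Fin (M + 2)) (p : ℝ × (Fin (M + 1) → ℝ)) (l : Fin (M + 1)) :
    splice k p (k.succAbove l) = (M + 2 - p.1) / (M + 1) * p.2 l := by simp [splice]

theorem continuous_splice {M : ℕ} (k : Fin (M + 2)) : Continuous (splice (M := M) k) := by
  apply continuous_pi
  intro l
  cases l using Fin.succAboveCases k with
  | x => simpa using continuous_fst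
  | p l => simp only [splice_succAbove]; fun_prop

/-- An exchange is linear in the energies, hence commutes with the rescaling of the unfrozen ones.
This lets the induction pass from N particles to N - 1. -/
theorem exchange_splice {M : ℕ} (k : Fin (M + 2)) (i j : Fin (M + 1)) (α t : ℝ)
    (ξ : Fin (M + 1) → ℝ) :
    exchange (k.succAbove i) (k.succAbove j) α (splice k (t, ξ)) =
      splice k (t, exchange i j α ξ) := by
  ext l
  cases l using Fin.succAboveCases k with
  | x => simp [exchange, (Fin.succAbove_ne k _).symm]
  | p l =>
    simp only [exchange, splice_succAbove, Fin.succAbove_right_inj]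
    split_ifs <;> ring

theorem pairAverage_splice {M : ℕ} (k : Fin (M + 2)) (i j : Fin (M + 1))
    (f : (Fin (M + 2) → ℝ) → ℝ) (t : ℝ) (ξ : Fin (M + 1) → ℝ) :
    pairAverage (k.succAbove i) (k.succAbove j) f (splice k (t, ξ)) =
      pairAverage i j (fun ξ => f (splice k (t, ξ))) ξ := by
  simp [pairAverage, exchange_splice]

theorem splice_mem_stateSpace {M : ℕ} (k : Fin (M + 2)) {t : ℝ}
    (ht : t ∈ Set.Icc 0 (M + 2 : ℝ)) {ξ : Fin (M + 1) → ℝ} (hξ : ξ ∈ stateSpace (M + 1)) :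
    splice k (t, ξ) ∈ stateSpace (M + 2) := by
  have hs := sum_eq_of_mem_stateSpace hξ
  apply mem_stateSpace_of_sum_eq
  · intro l
    cases l using Fin.succAboveCases k with
    | x => simpa using ht.1
    | p l =>
      rw [splice_succAbove]
      exact mul_nonneg (div_nonneg (sub_nonneg.2 ht.2) (by positivity)) (hξ.1 l)
  · rw [Fin.sum_univ_succAbove _ k]
    simp only [splice_same, splice_succAbove]
    rw [← Finset.mul_sum, hs]
    have : (M : ℝ) + 1 ≠ 0 := by positivity
    push_cast
    field_simp
    ring

instance (M : ℕ) : IsProbabilityMeasure (marginal M) := by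
  constructor
  have h0 : (0 : ℝ) ≤ M + 2 := by positivity
  rw [marginal, withDensity_apply _ MeasurableSet.univ, Measure.restrict_univ]
  have h := lintegral_pow_mul_sub_pow h0 0 M
  simp only [pow_zero, one_mul] at h
  simp_rw [ENNReal.ofReal_mul (show (0 : ℝ) ≤ (M + 1) / (M + 2) ^ (M + 1) by positivity)]
  rw [lintegral_const_mul _ (by fun_prop), h, ← ENNReal.ofReal_mul (by positivity),
    ← ENNReal.ofReal_one]
  congr 1
  have : (M ! : ℝ) ≠ 0 := by exact_mod_cast M.factorial_ne_zero
  have h2 : (M + 2 : ℝ) ≠ 0 := by positivity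
  rw [zero_add, Nat.factorial_succ]
  push_cast
  simp only [Nat.factorial_zero, Nat.cast_one]
  field_simp

theorem ae_mem_marginal (M : ℕ) : ∀ᵐ t ∂marginal M, t ∈ Set.Icc 0 (M + 2 : ℝ) :=
  (withDensity_absolutelyContinuous _ _).ae_le (ae_restrict_mem measurableSet_Icc)

theorem integral_pow_mul_sub_pow_marginal (M a b : ℕ) :
    ∫ t, t ^ a * (M + 2 - t) ^ b ∂marginal M =
      (M + 1) * a ! * (b + M)! / (a + b + M + 1)! * (M + 2 : ℝ) ^ (a + b) := by
  have h0 : (0 : ℝ) ≤ M + 2 := by positivity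
  rw [marginal, integral_withDensity_eq_integral_toReal_smul (by fun_prop)
    (by filter_upwards with t using ENNReal.ofReal_lt_top)]
  have h1 : ∀ t ∈ Set.Icc 0 (M + 2 : ℝ),
      (ENNReal.ofReal ((M + 1) / (M + 2) ^ (M + 1) * (M + 2 - t) ^ M)).toReal •
        (t ^ a * (M + 2 - t) ^ b) =
      (M + 1) / (M + 2) ^ (M + 1) * (t ^ a * (M + 2 - t) ^ (b + M)) := by
    intro t ht
    rw [ENNReal.toReal_ofReal (mul_nonneg (by positivity) (pow_nonneg (sub_nonneg.2 ht.2) _)),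
      smul_eq_mul]
    ring
  rw [setIntegral_congr_fun measurableSet_Icc h1, integral_const_mul, integral_Icc_eq_integral_Ioc,
    ← intervalIntegral.integral_of_le h0, integral_pow_mul_sub_pow,
    show a + (b + M) + 1 = a + b + (M + 1) by ring, pow_add _ (a + b)]
  have h2 : (M + 2 : ℝ) ^ (M + 1) ≠ 0 := by positivity
  field_simp
  ring_nf

/-- The flat Dirichlet law is a frozen coordinate together with an independent, rescaled flat
Dirichlet vector with one particle fewer. Monomials factor over the product, so the moment formulas
decide. -/
theorem measurePreserving_splice {M : ℕ} (k : Fin (M + 2)) :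
    MeasurePreserving (splice k) ((marginal M).prod (sigma (M + 1))) (sigma (M + 2)) := by
  have hc := continuous_splice k
  refine ⟨hc.measurable, ?_⟩
  have : IsProbabilityMeasure (Measure.map (splice k) ((marginal M).prod (sigma (M + 1)))) :=
    Measure.isProbabilityMeasure_map hc.aemeasurable
  refine ext_of_integral_monomial (isCompact_box _) ?_ (ae_mem_box (M + 1)) fun a => ?_
  · refine (ae_map_iff (p := (· ∈ box (M + 2))) hc.aemeasurable
      (isCompact_box _).measurableSet).2 ?_
    have h1 : ∀ᵐ p ∂(marginal M).prod (sigma (M + 1)), p.1 ∈ Set.Icc 0 (M + 2 : ℝ) :=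
      Measure.quasiMeasurePreserving_fst.ae (ae_mem_marginal M)
    have h2 : ∀ᵐ p ∂(marginal M).prod (sigma (M + 1)), p.2 ∈ stateSpace (M + 1) :=
      Measure.quasiMeasurePreserving_snd.ae (ae_mem_stateSpace M)
    filter_upwards [h1, h2] with p hp1 hp2
    exact stateSpace_subset_box _ (splice_mem_stateSpace k hp1 hp2)
  · rw [integral_map hc.aemeasurable (Continuous.aestronglyMeasurable (by fun_prop))]
    set n := ∑ l, a (k.succAbove l) with hn
    have h1 : ∀ p : ℝ × (Fin (M + 1) → ℝ), ∏ l, splice k p l ^ a l =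
        (1 / (M + 1 : ℝ) ^ n * (p.1 ^ a k * (M + 2 - p.1) ^ n)) *
          ∏ l, p.2 l ^ a (k.succAbove l) := by
      intro p
      rw [Fin.prod_univ_succAbove _ k]
      simp only [splice_same, splice_succAbove, mul_pow, Finset.prod_mul_distrib]
      rw [Finset.prod_pow_eq_pow_sum, div_pow, ← hn]
      ring
    simp_rw [h1]
    rw [integral_prod_mul (fun t : ℝ => 1 / (M + 1 : ℝ) ^ n * (t ^ a k * (M + 2 - t) ^ n))
      (fun ξ : Fin (M + 1) → ℝ => ∏ l, ξ l ^ a (k.succAbove l)), integral_const_mul,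
      integral_pow_mul_sub_pow_marginal, integral_prod_pow_sigma, integral_prod_pow_sigma,
      Fin.prod_univ_succAbove _ k, Fin.sum_univ_succAbove _ k, ← hn, Nat.factorial_succ M]
    have h3 : (M + 1 : ℝ) ^ n ≠ 0 := by positivity
    have h4 : ((n + M)! : ℝ) ≠ 0 := by exact_mod_cast Nat.factorial_ne_zero _
    push_cast
    rw [show (M : ℝ) + 1 + 1 = M + 2 by ring, ← add_assoc]
    field_simp

theorem integral_comp_coord {M : ℕ} (k : Fin (M + 2)) {g : ℝ → ℝ} (hg : Continuous g) :
    ∫ η, g (η k) ∂sigma (M + 2) = ∫ t, g t ∂marginal M := by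
  rw [← (measurePreserving_splice k).map_eq, integral_map (continuous_splice k).aemeasurable
    (Continuous.aestronglyMeasurable (by fun_prop))]
  simp only [splice_same]
  rw [integral_fun_fst]
  simp

end StochasticExchange

/-! ### Symmetric operators that are triangular along a flag -/

namespace StochasticExchange
open scoped Nat InnerProductSpace
open InnerProductSpace (gramSchmidt)

section Triangular

variable {E : Type*} [NormedAddCommGroup E] [InnerProductSpace ℝ E] {T : E →ₗ[ℝ] E}
  {v : ℕ → E} {κ : ℕ → ℝ}

theorem map_mem_span_of_triangular
    (htri : ∀ n, T (v n) - κ n • v n ∈ Submodule.span ℝ (v '' Set.Iio n)) (n : ℕ) {y : E}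
    (hy : y ∈ Submodule.span ℝ (v '' Set.Iio n)) : T y ∈ Submodule.span ℝ (v '' Set.Iio n) := by
  induction hy using Submodule.span_induction with
  | mem x hx =>
    obtain ⟨m, hm, rfl⟩ := hx
    rw [← sub_add_cancel (T (v m)) (κ m • v m)]
    refine Submodule.add_mem _ ?_ (Submodule.smul_mem _ _ (Submodule.subset_span ⟨m, hm, rfl⟩))
    exact Submodule.span_mono (Set.image_mono (Set.Iio_subset_Iio (le_of_lt hm))) (htri m)
  | zero => simp
  | add x y _ _ hx hy => rw [map_add]; exact Submodule.add_mem _ hx hy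
  | smul c x _ hx => rw [map_smul]; exact Submodule.smul_mem _ _ hx

theorem gramSchmidt_sub_mem_span (v : ℕ → E) (n : ℕ) :
    gramSchmidt ℝ v n - v n ∈ Submodule.span ℝ (v '' Set.Iio n) := by
  rw [InnerProductSpace.gramSchmidt_def, sub_sub_cancel_left]
  refine Submodule.neg_mem _ (Submodule.sum_mem _ fun i hi => ?_)
  rw [Submodule.starProjection_singleton]
  refine Submodule.smul_mem _ _ ?_
  have hi' : Set.Iic i ⊆ Set.Iio n := Set.Iic_subset_Iio.2 (Finset.mem_Iio.1 hi)
  exact Submodule.span_mono (Set.image_mono hi') (InnerProductSpace.gramSchmidt_mem_span ℝ v le_rfl)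

theorem inner_gramSchmidt_eq_zero (v : ℕ → E) (n : ℕ) {y : E}
    (hy : y ∈ Submodule.span ℝ (v '' Set.Iio n)) : ⟪gramSchmidt ℝ v n, y⟫_ℝ = 0 := by
  rw [← InnerProductSpace.span_gramSchmidt_Iio] at hy
  induction hy using Submodule.span_induction with
  | mem x hx =>
    obtain ⟨m, hm, rfl⟩ := hx
    exact InnerProductSpace.gramSchmidt_orthogonal ℝ v (ne_of_gt hm)
  | zero => simp
  | add x y _ _ hx hy => rw [inner_add_right, hx, hy, add_zero]
  | smul c x _ hx => rw [inner_smul_right, hx, mul_zero]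

/-- The residual `T e - κ n • e` lies in the span of the earlier vectors by triangularity. By
symmetry it is also orthogonal to that span, which `T` preserves, so it is zero. -/
theorem map_gramSchmidt (hT : T.IsSymmetric)
    (htri : ∀ n, T (v n) - κ n • v n ∈ Submodule.span ℝ (v '' Set.Iio n)) (n : ℕ) :
    T (gramSchmidt ℝ v n) = κ n • gramSchmidt ℝ v n := by
  set e := gramSchmidt ℝ v n with he
  have h1 : T e - κ n • e ∈ Submodule.span ℝ (v '' Set.Iio n) := by
    have h2 := gramSchmidt_sub_mem_span v n
    rw [← he] at h2
    have h3 : T e - κ n • e = T (e - v n) - κ n • (e - v n) + (T (v n) - κ n • v n) := by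
      rw [map_sub, smul_sub]; abel
    rw [h3]
    exact Submodule.add_mem _ (Submodule.sub_mem _ (map_mem_span_of_triangular htri n h2)
      (Submodule.smul_mem _ _ h2)) (htri n)
  have h4 : ⟪T e - κ n • e, T e - κ n • e⟫_ℝ = 0 := by
    rw [inner_sub_left (T e), hT, inner_smul_left,
      inner_gramSchmidt_eq_zero v n (map_mem_span_of_triangular htri n h1),
      inner_gramSchmidt_eq_zero v n h1]
    simp
  exact sub_eq_zero.1 (inner_self_eq_zero.1 h4)

/-- The vectors `v n` span algebraically, so `x` is a finite combination of Gram–Schmidt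
eigenvectors and no completeness or spectral theorem is needed. Orthogonality to `v 0` removes the
eigenvalue `κ 0`. -/
theorem inner_map_bounds_of_triangular (hT : T.IsSymmetric)
    (htri : ∀ n, T (v n) - κ n • v n ∈ Submodule.span ℝ (v '' Set.Iio n))
    (hspan : Submodule.span ℝ (Set.range v) = ⊤) {a b : ℝ} (ha : ∀ n, n ≠ 0 → a ≤ κ n)
    (hb : ∀ n, n ≠ 0 → κ n ≤ b) {x : E} (hx : ⟪v 0, x⟫_ℝ = 0) :
    a * ‖x‖ ^ 2 ≤ ⟪T x, x⟫_ℝ ∧ ⟪T x, x⟫_ℝ ≤ b * ‖x‖ ^ 2 := by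
  set e := gramSchmidt ℝ v with he
  have hx' : x ∈ Submodule.span ℝ (Set.range e) := by
    rw [he, InnerProductSpace.span_gramSchmidt, hspan]; trivial
  obtain ⟨c, rfl⟩ := Finsupp.mem_span_range_iff_exists_finsupp.1 hx'
  have horth : ∀ m n, m ≠ n → ⟪e m, e n⟫_ℝ = 0 := fun m n h =>
    InnerProductSpace.gramSchmidt_orthogonal ℝ v h
  have hTe : ∀ n, T (e n) = κ n • e n := map_gramSchmidt hT htri
  have hinner : ∀ m, ⟪e m, c.sum fun i a => a • e i⟫_ℝ = c m * ‖e m‖ ^ 2 := by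
    intro m
    rw [Finsupp.sum, inner_sum, Finset.sum_eq_single m]
    · rw [inner_smul_right, real_inner_self_eq_norm_sq]
    · intro n _ hn
      rw [inner_smul_right, horth m n hn.symm, mul_zero]
    · intro hm
      rw [Finsupp.notMem_support_iff.1 hm]; simp
  have h0 : c 0 * ‖e 0‖ ^ 2 = 0 := by
    rw [← hinner, he, ← hx]
    congr 1
    exact InnerProductSpace.gramSchmidt_bot ℝ v
  have hn : ‖c.sum fun i a => a • e i‖ ^ 2 = ∑ m ∈ c.support, c m * (c m * ‖e m‖ ^ 2) := by
    rw [← real_inner_self_eq_norm_sq]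
    conv_lhs => rw [Finsupp.sum, sum_inner]
    refine Finset.sum_congr rfl fun m _ => ?_
    rw [real_inner_smul_left, ← hinner, Finsupp.sum]
  have hTn : ⟪T (c.sum fun i a => a • e i), c.sum fun i a => a • e i⟫_ℝ =
      ∑ m ∈ c.support, κ m * (c m * (c m * ‖e m‖ ^ 2)) := by
    conv_lhs => rw [Finsupp.sum, map_sum, sum_inner]
    refine Finset.sum_congr rfl fun m _ => ?_
    rw [map_smul, hTe, real_inner_smul_left, real_inner_smul_left, ← hinner, Finsupp.sum]
    ring
  rw [hTn, hn, Finset.mul_sum, Finset.mul_sum]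
  have hpos : ∀ m, 0 ≤ c m * (c m * ‖e m‖ ^ 2) := fun m => by
    rw [← mul_assoc]; exact mul_nonneg (mul_self_nonneg _) (sq_nonneg _)
  constructor <;> refine Finset.sum_le_sum fun m _ => ?_ <;> rcases eq_or_ne m 0 with rfl | hm
  · rw [h0]; simp
  · exact mul_le_mul_of_nonneg_right (ha m hm) (hpos m)
  · rw [h0]; simp
  · exact mul_le_mul_of_nonneg_right (hb m hm) (hpos m)

/-- The left side is the squared norm of ∑ p_k(η_k) when `T` gives the correlation of two distinct
coordinates. Writing p_k = S/N + d_k with ∑ d_k = 0, the form acts as 1 + (N-1)T on the common part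
and as 1 - T on the deviations; the two eigenvalue bounds control one part each. -/
theorem sum_norm_sq_add_cross_le {N : ℕ} (hN : 2 ≤ N)
    (h : ∀ x, ⟪v 0, x⟫_ℝ = 0 → -(1 / (N - 1 : ℝ)) * ‖x‖ ^ 2 ≤ ⟪T x, x⟫_ℝ ∧
      ⟪T x, x⟫_ℝ ≤ 2 / (N * (N - 1 : ℝ)) * ‖x‖ ^ 2)
    (p : Fin N → E) (hp : ∀ k, ⟪v 0, p k⟫_ℝ = 0) :
    ∑ k, ‖p k‖ ^ 2 + (⟪T (∑ k, p k), ∑ k, p k⟫_ℝ - ∑ k, ⟪T (p k), p k⟫_ℝ) ≤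
      (1 + 2 / (N : ℝ)) * ∑ k, ‖p k‖ ^ 2 := by
  set S := ∑ k, p k with hS
  have hN' : (2 : ℝ) ≤ N := by exact_mod_cast hN
  have hN0 : (N : ℝ) ≠ 0 := by positivity
  have hN1 : (N : ℝ) - 1 ≠ 0 := by linarith
  have hS0 : ⟪v 0, S⟫_ℝ = 0 := by rw [hS, inner_sum]; simp [hp]
  let d : Fin N → E := fun k => p k - (1 / (N : ℝ)) • S
  have hd : ∀ k, ⟪v 0, d k⟫_ℝ = 0 := fun k => by
    simp only [d, inner_sub_right, inner_smul_right, hS0, hp]; simp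
  have hdn : ∑ k, ‖d k‖ ^ 2 = ∑ k, ‖p k‖ ^ 2 - ‖S‖ ^ 2 / N := by
    simp only [d, norm_sub_sq_real, inner_smul_right, norm_smul, mul_pow]
    rw [Finset.sum_add_distrib, Finset.sum_sub_distrib, ← Finset.mul_sum, ← Finset.mul_sum,
      ← sum_inner, ← hS, real_inner_self_eq_norm_sq]
    simp
    field_simp
    ring
  have hTd : ∑ k, ⟪T (d k), d k⟫_ℝ = ∑ k, ⟪T (p k), p k⟫_ℝ - ⟪T S, S⟫_ℝ / N := by
    simp only [d, map_sub, map_smul, inner_sub_left, inner_sub_right, inner_smul_right,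
      real_inner_smul_left]
    have h1 : ∑ k, ⟪T S, p k⟫_ℝ = ⟪T S, S⟫_ℝ := by rw [← inner_sum]
    have h2 : ∑ k, ⟪T (p k), S⟫_ℝ = ⟪T S, S⟫_ℝ := by rw [← sum_inner, ← map_sum]
    simp only [Finset.sum_sub_distrib, ← Finset.mul_sum, h1, h2]
    simp
    field_simp
    ring
  have key1 : -(1 / (N - 1 : ℝ)) * ∑ k, ‖d k‖ ^ 2 ≤ ∑ k, ⟪T (d k), d k⟫_ℝ := by
    rw [Finset.mul_sum]
    exact Finset.sum_le_sum fun k _ => (h _ (hd k)).1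
  have key2 := (h S hS0).2
  have hdpos : 0 ≤ ∑ k, ‖d k‖ ^ 2 := Finset.sum_nonneg fun _ _ => sq_nonneg _
  have e1 : ⟪T S, S⟫_ℝ - ∑ k, ⟪T (p k), p k⟫_ℝ =
      (1 - 1 / (N : ℝ)) * ⟪T S, S⟫_ℝ - ∑ k, ⟪T (d k), d k⟫_ℝ := by rw [hTd]; ring
  have e2 : ∑ k, ‖p k‖ ^ 2 = ∑ k, ‖d k‖ ^ 2 + ‖S‖ ^ 2 / N := by rw [hdn]; ring
  -- The common part sets the constant: (N-1) · 2/(N(N-1)) = 2/N.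
  have e3 : (1 - 1 / (N : ℝ)) * ⟪T S, S⟫_ℝ ≤ 2 / N * (‖S‖ ^ 2 / N) := by
    calc (1 - 1 / (N : ℝ)) * ⟪T S, S⟫_ℝ
        ≤ (1 - 1 / (N : ℝ)) * (2 / (N * (N - 1 : ℝ)) * ‖S‖ ^ 2) := by
          apply mul_le_mul_of_nonneg_left key2
          rw [sub_nonneg, div_le_one (by positivity)]; linarith
      _ = _ := by field_simp
  -- Here 1/(N-1) ≤ 2/N, which is equivalent to N ≥ 2.
  have e4 : 1 / (N - 1 : ℝ) * ∑ k, ‖d k‖ ^ 2 ≤ 2 / N * ∑ k, ‖d k‖ ^ 2 := by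
    apply mul_le_mul_of_nonneg_right _ hdpos
    rw [div_le_div_iff₀ (by linarith) (by positivity)]
    linarith
  rw [e1]
  have e5 : (1 + 2 / (N : ℝ)) * ∑ k, ‖p k‖ ^ 2 =
      ∑ k, ‖p k‖ ^ 2 + 2 / N * ∑ k, ‖d k‖ ^ 2 + 2 / N * (‖S‖ ^ 2 / N) := by
    conv_lhs => rw [add_mul, one_mul]
    conv_lhs => rw [e2]
    rw [e2]; ring
  rw [e5]
  linarith

end Triangular

end StochasticExchange

/-! ### The correlation operator on polynomials and its eigenvalues -/

namespace StochasticExchange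
open scoped Nat InnerProductSpace Polynomial
open Polynomial (C X)

theorem isCompact_Icc_marginal (M : ℕ) : IsCompact (Set.Icc 0 (M + 2 : ℝ)) := isCompact_Icc

theorem integrable_marginal_of_continuous {M : ℕ} {g : ℝ → ℝ} (hg : Continuous g) :
    Integrable g (marginal M) :=
  integrable_of_continuous_of_ae_mem (isCompact_Icc_marginal M) (ae_mem_marginal M) hg

/-- A nonzero polynomial has finitely many roots, a null set for a law with a density. This is
definiteness of the inner product below. -/
theorem eq_zero_of_integral_eval_sq_eq_zero {M : ℕ} {p : ℝ[X]}
    (h : ∫ t, p.eval t * p.eval t ∂marginal M = 0) : p = 0 := by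
  by_contra hp
  have h1 := (integral_eq_zero_iff_of_nonneg (fun t => mul_self_nonneg (p.eval t))
    (integrable_marginal_of_continuous (by fun_prop))).1 h
  have h2 : ∀ᵐ t ∂marginal M, t ∉ (p.roots.toFinset : Set ℝ) := by
    apply ((withDensity_absolutelyContinuous _ _).trans Measure.absolutelyContinuous_restrict).ae_le
    exact compl_mem_ae_iff.2 (Finset.measure_zero _ _)
  obtain ⟨t, ht1, ht2⟩ := (h1.and h2).exists
  apply ht2
  simpa [hp] using ht1

/-- The inner product of polynomials in a single coordinate. -/
noncomputable abbrev polynomialCore (M : ℕ) : InnerProductSpace.Core ℝ ℝ[X] where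
  inner p q := ∫ t, p.eval t * q.eval t ∂marginal M
  conj_inner_symm p q := by simp [mul_comm]
  re_inner_nonneg p := integral_nonneg fun t => mul_self_nonneg _
  add_left p q r := by
    simp only [Polynomial.eval_add, add_mul]
    exact integral_add (integrable_marginal_of_continuous (by fun_prop))
      (integrable_marginal_of_continuous (by fun_prop))
  smul_left p q c := by
    simp only [Polynomial.eval_smul, smul_eq_mul, mul_assoc]
    exact integral_const_mul _ _
  definite p h := eq_zero_of_integral_eval_sq_eq_zero h

/-- The modulus of the `n`-th eigenvalue of the correlation operator of two coordinates. -/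
noncomputable def eigenvalue (M n : ℕ) : ℝ := n ! * M ! / (n + M)!

/-- The action on polynomials of the conditional expectation, given one coordinate, of a function
of another coordinate. -/
noncomputable def correlation (M : ℕ) : ℝ[X] →ₗ[ℝ] ℝ[X] :=
  (Polynomial.basisMonomials ℝ).constr ℝ
    fun n => eigenvalue M n • (C (M + 2 : ℝ) - X) ^ n

theorem correlation_monomial (M n : ℕ) :
    correlation M (Polynomial.monomial n 1) = eigenvalue M n • (C (M + 2 : ℝ) - X) ^ n := by
  have := (Polynomial.basisMonomials ℝ).constr_basis ℝ
    (fun n => eigenvalue M n • (C (M + 2 : ℝ) - X) ^ n) n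
  rwa [Polynomial.coe_basisMonomials] at this

theorem integral_pow_mul_pow_sigma {M : ℕ} {i j : Fin (M + 2)} (hij : i ≠ j) (l m : ℕ) :
    ∫ η, η i ^ l * η j ^ m ∂sigma (M + 2) =
      (l ! : ℝ) * m ! * (M + 1)! / (l + m + M + 1)! * (M + 2) ^ (l + m) := by
  let a : Fin (M + 2) → ℕ := Function.update (Function.update 0 i l) j m
  have hi : a i = l := by simp [a, hij]
  have hj : a j = m := by simp [a]
  have hk : ∀ k ∈ (Finset.univ.erase i).erase j, a k = 0 := fun k hk => by
    simp only [Finset.mem_erase, Finset.mem_univ, and_true] at hk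
    simp [a, hk.1, hk.2]
  have h := integral_prod_pow_sigma (M + 1) a
  have h1 : ∀ η : Fin (M + 2) → ℝ, ∏ k, η k ^ a k = η i ^ l * η j ^ m := by
    intro η
    rw [prod_eq_mul_mul_prod_erase hij, hi, hj, Finset.prod_eq_one, mul_one]
    intro k hk'
    rw [hk k hk', pow_zero]
  have h2 : ∑ k, a k = l + m := by
    rw [sum_eq_add_add_sum_erase hij, hi, hj, Finset.sum_eq_zero hk, add_zero]
  have h3 : ∏ k, ((a k)! : ℝ) = l ! * m ! := by
    rw [prod_eq_mul_mul_prod_erase hij, hi, hj, Finset.prod_eq_one, mul_one]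
    intro k hk'
    rw [hk k hk']; simp
  simp_rw [h1] at h
  rw [h, h2, h3, ← add_assoc]
  push_cast
  ring

/-- By bilinearity it suffices to compare moments of monomials. This identifies the operator without
handling conditional expectations. -/
theorem integral_eval_mul_eval {M : ℕ} {i j : Fin (M + 2)} (hij : i ≠ j) (p q : ℝ[X]) :
    ∫ η, p.eval (η i) * q.eval (η j) ∂sigma (M + 2) =
      ∫ t, (correlation M p).eval t * q.eval t ∂marginal M := by
  induction p using Polynomial.induction_on' with
  | add p r hp hr =>
    simp only [Polynomial.eval_add, add_mul, map_add]
    rw [integral_add (integrable_of_continuous (by fun_prop))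
      (integrable_of_continuous (by fun_prop)), hp, hr,
      integral_add (integrable_marginal_of_continuous (by fun_prop))
      (integrable_marginal_of_continuous (by fun_prop))]
  | monomial l a =>
    induction q using Polynomial.induction_on' with
    | add q r hq hr =>
      simp only [Polynomial.eval_add, mul_add]
      rw [integral_add (integrable_of_continuous (by fun_prop))
        (integrable_of_continuous (by fun_prop)), hq, hr,
        integral_add (integrable_marginal_of_continuous (by fun_prop))
        (integrable_marginal_of_continuous (by fun_prop))]
    | monomial m b =>
      have h1 : Polynomial.monomial l a = a • Polynomial.monomial l (1 : ℝ) := by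
        rw [Polynomial.smul_monomial, smul_eq_mul, mul_one]
      rw [h1, map_smul, correlation_monomial]
      simp only [Polynomial.eval_smul, Polynomial.eval_monomial, smul_eq_mul, one_mul,
        Polynomial.eval_pow, Polynomial.eval_sub, Polynomial.eval_C, Polynomial.eval_X]
      have h2 : ∀ η : Fin (M + 2) → ℝ,
          a * η i ^ l * (b * η j ^ m) = a * b * (η i ^ l * η j ^ m) := fun η => by ring
      have h3 : ∀ t : ℝ, a * (eigenvalue M l * (M + 2 - t) ^ l) * (b * t ^ m) =
          a * b * eigenvalue M l * (t ^ m * (M + 2 - t) ^ l) := fun t => by ring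
      simp_rw [h2, h3]
      rw [integral_const_mul, integral_const_mul, integral_pow_mul_pow_sigma hij,
        integral_pow_mul_sub_pow_marginal, eigenvalue, Nat.factorial_succ M, add_comm m l]
      have : ((l + M)! : ℝ) ≠ 0 := by exact_mod_cast Nat.factorial_ne_zero _
      push_cast
      field_simp

theorem correlation_triangular (M n : ℕ) :
    correlation M (Polynomial.monomial n 1) -
      ((-1) ^ n * eigenvalue M n) • (Polynomial.monomial n (1 : ℝ)) ∈
      Submodule.span ℝ ((fun m => Polynomial.monomial m (1 : ℝ)) '' Set.Iio n) := by
  rw [correlation_monomial, mul_comm, mul_smul, ← smul_sub]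
  apply Submodule.smul_mem
  have h : (C (M + 2 : ℝ) - X) ^ n - (-1 : ℝ) ^ n • (Polynomial.monomial n (1 : ℝ)) =
      ∑ m ∈ Finset.range n, ((-1 : ℝ) ^ m * (M + 2) ^ (n - m) * (n.choose m)) •
        Polynomial.monomial m (1 : ℝ) := by
    have h0 : ∀ m, (-X : ℝ[X]) ^ m = (-1 : ℝ) ^ m • Polynomial.monomial m 1 := fun m => by
      rw [neg_pow, ← Polynomial.X_pow_eq_monomial, Polynomial.smul_eq_C_mul]
      simp
    rw [sub_eq_neg_add (C _) X, add_pow, Finset.sum_range_succ, h0 n]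
    simp only [Nat.sub_self, pow_zero, mul_one, Nat.choose_self, Nat.cast_one, add_sub_cancel_right]
    refine Finset.sum_congr rfl fun m _ => ?_
    rw [h0, ← Polynomial.C_pow, Polynomial.smul_eq_C_mul, Polynomial.smul_eq_C_mul]
    simp
    ring
  rw [h]
  exact Submodule.sum_mem _ fun m hm => Submodule.smul_mem _ _
    (Submodule.subset_span ⟨m, Finset.mem_range.1 hm, rfl⟩)

theorem eigenvalue_nonneg (M n : ℕ) : 0 ≤ eigenvalue M n := by unfold eigenvalue; positivity

theorem eigenvalue_antitone (M : ℕ) : Antitone (eigenvalue M) := by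
  refine antitone_nat_of_succ_le fun n => ?_
  unfold eigenvalue
  rw [show n + 1 + M = (n + M) + 1 by ring, Nat.factorial_succ, Nat.factorial_succ (n + M),
    div_le_div_iff₀ (by positivity) (by positivity)]
  push_cast
  have h1 : (0 : ℝ) ≤ n ! * M ! * (n + M)! * M := by positivity
  nlinarith

theorem eigenvalue_one (M : ℕ) : eigenvalue M 1 = 1 / (M + 1) := by
  unfold eigenvalue
  rw [add_comm 1 M, Nat.factorial_succ M]
  have : (M ! : ℝ) ≠ 0 := by exact_mod_cast Nat.factorial_ne_zero _
  push_cast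
  field_simp
  simp

theorem eigenvalue_two (M : ℕ) : eigenvalue M 2 = 2 / ((M + 2) * (M + 1)) := by
  unfold eigenvalue
  rw [show 2 + M = M + 1 + 1 by ring, Nat.factorial_succ (M + 1), Nat.factorial_succ M]
  have : (M ! : ℝ) ≠ 0 := by exact_mod_cast Nat.factorial_ne_zero _
  push_cast
  field_simp
  norm_num [Nat.factorial]
  ring

/-- The moduli decrease in `n`, so the largest positive value is at `n = 2` and the most negative at
`n = 1`. -/
theorem signed_eigenvalue_bounds (M n : ℕ) (hn : n ≠ 0) :
    -(1 / (M + 1 : ℝ)) ≤ (-1) ^ n * eigenvalue M n ∧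
      (-1) ^ n * eigenvalue M n ≤ 2 / ((M + 2) * (M + 1 : ℝ)) := by
  rw [← eigenvalue_one, ← eigenvalue_two]
  have h0 := eigenvalue_nonneg M n
  have h1 := eigenvalue_nonneg M 1
  have h2 := eigenvalue_nonneg M 2
  rcases n.even_or_odd with h | h
  · rw [h.neg_one_pow, one_mul]
    refine ⟨by linarith, eigenvalue_antitone M ?_⟩
    obtain ⟨k, rfl⟩ := h
    omega
  · rw [h.neg_one_pow]
    have := eigenvalue_antitone M (Nat.one_le_iff_ne_zero.2 hn)
    constructor <;> linarith

theorem integral_sq_sum_eval_le (M : ℕ) (p : Fin (M + 2) → ℝ[X])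
    (hp : ∀ k, ∫ t, (p k).eval t ∂marginal M = 0) :
    ∫ η, (∑ k, (p k).eval (η k)) ^ 2 ∂sigma (M + 2) ≤
      (1 + 2 / (M + 2 : ℝ)) * ∑ k, ∫ η, (p k).eval (η k) ^ 2 ∂sigma (M + 2) := by
  let core := polynomialCore M
  let _ : NormedAddCommGroup ℝ[X] := core.toNormedAddCommGroup
  let _ : InnerProductSpace ℝ ℝ[X] := InnerProductSpace.ofCore core.toCore
  have hin : ∀ p q : ℝ[X], ⟪p, q⟫_ℝ = ∫ t, p.eval t * q.eval t ∂marginal M := fun _ _ => rfl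
  have hij : ∀ {i j : Fin (M + 2)}, i ≠ j → ∀ p q : ℝ[X],
      ∫ η, p.eval (η i) * q.eval (η j) ∂sigma (M + 2) = ⟪correlation M p, q⟫_ℝ :=
    fun h p q => integral_eval_mul_eval h p q
  have hii : ∀ (i : Fin (M + 2)) (p q : ℝ[X]),
      ∫ η, p.eval (η i) * q.eval (η i) ∂sigma (M + 2) = ⟪p, q⟫_ℝ :=
    fun i p q => integral_comp_coord i (g := fun t => p.eval t * q.eval t) (by fun_prop)
  -- Symmetry comes from reading the same correlation with coordinates 0 and 1 interchanged.
  have hT : (correlation M).IsSymmetric := by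
    intro p q
    have h01 : (0 : Fin (M + 2)) ≠ 1 := by simp
    rw [real_inner_comm (correlation M q), ← hij h01, ← hij h01.symm]
    simp_rw [mul_comm]
  have hspan : Submodule.span ℝ (Set.range fun n => Polynomial.monomial n (1 : ℝ)) = ⊤ := by
    rw [← Polynomial.coe_basisMonomials]
    exact (Polynomial.basisMonomials ℝ).span_eq
  have hbound : ∀ x : ℝ[X], ⟪Polynomial.monomial 0 (1 : ℝ), x⟫_ℝ = 0 →
      -(1 / (((M + 2 : ℕ) : ℝ) - 1)) * ‖x‖ ^ 2 ≤ ⟪correlation M x, x⟫_ℝ ∧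
      ⟪correlation M x, x⟫_ℝ ≤ 2 / (((M + 2 : ℕ) : ℝ) * (((M + 2 : ℕ) : ℝ) - 1)) * ‖x‖ ^ 2 := by
    intro x hx
    have e : ((M + 2 : ℕ) : ℝ) - 1 = M + 1 := by push_cast; ring
    rw [e]
    push_cast
    exact inner_map_bounds_of_triangular (v := fun n => Polynomial.monomial n (1 : ℝ))
      (κ := fun n => (-1) ^ n * eigenvalue M n) hT
      (correlation_triangular M) hspan (fun n hn => (signed_eigenvalue_bounds M n hn).1)
      (fun n hn => (signed_eigenvalue_bounds M n hn).2) hx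
  have key := sum_norm_sq_add_cross_le (v := fun n => Polynomial.monomial n (1 : ℝ))
    (T := correlation M) (by omega) hbound p (fun k => by
      rw [hin]; simpa using hp k)
  have hsq : ∀ k, ∫ η, (p k).eval (η k) ^ 2 ∂sigma (M + 2) = ‖p k‖ ^ 2 := by
    intro k
    simp_rw [pow_two ((p k).eval _), hii, real_inner_self_eq_norm_sq]
  have hexp : ∫ η, (∑ k, (p k).eval (η k)) ^ 2 ∂sigma (M + 2) =
      ∑ k, ‖p k‖ ^ 2 + (⟪correlation M (∑ k, p k), ∑ k, p k⟫_ℝ -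
        ∑ k, ⟪correlation M (p k), p k⟫_ℝ) := by
    simp_rw [pow_two (∑ k, _), Finset.sum_mul_sum]
    rw [integral_finsetSum _ fun k _ => integrable_of_continuous (by fun_prop)]
    rw [Finset.sum_congr rfl fun i _ => integral_finsetSum _ fun j _ =>
      integrable_of_continuous (f := fun η => (p i).eval (η i) * (p j).eval (η j)) (by fun_prop)]
    have : ∀ i j, ∫ η, (p i).eval (η i) * (p j).eval (η j) ∂sigma (M + 2) =
        ⟪correlation M (p i), p j⟫_ℝ + if i = j then ‖p i‖ ^ 2 - ⟪correlation M (p i), p i⟫_ℝ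
          else 0 := by
      intro i j
      split_ifs with h
      · subst h
        rw [hii, real_inner_self_eq_norm_sq]; ring
      · rw [hij h, add_zero]
    simp_rw [this, Finset.sum_add_distrib]
    rw [map_sum, sum_inner]
    simp_rw [inner_sum]
    simp only [Finset.sum_ite_eq, Finset.mem_univ, if_true, Finset.sum_sub_distrib]
    ring
  rw [hexp]
  simp_rw [hsq]
  push_cast at key
  exact key

end StochasticExchange

/-! ### From polynomials to L², and the dual inequality -/

namespace StochasticExchange
open scoped Nat InnerProductSpace Polynomial

theorem coeFn_sum_Lp {X ι : Type*} [MeasurableSpace X] {μ : Measure X} (s : Finset ι)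
    (h : ι → Lp ℝ 2 μ) : ⇑(∑ k ∈ s, h k) =ᵐ[μ] ∑ k ∈ s, ⇑(h k) := by
  classical
  induction s using Finset.induction_on with
  | empty => simpa using Lp.coeFn_zero ℝ 2 μ
  | insert k s hk ih =>
    rw [Finset.sum_insert hk, Finset.sum_insert hk]
    exact (Lp.coeFn_add _ _).trans (ih.mono fun x hx => by
      rw [Pi.add_apply, hx, Pi.add_apply])

theorem norm_sq_eq_integral {X : Type*} [MeasurableSpace X] {μ : Measure X} (h : Lp ℝ 2 μ)
    {f : X → ℝ} (hf : h =ᵐ[μ] f) : ‖h‖ ^ 2 = ∫ x, f x ^ 2 ∂μ := by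
  rw [← real_inner_self_eq_norm_sq, L2.inner_def]
  refine integral_congr_ae ?_
  filter_upwards [hf] with x hx
  simp [hx, pow_two]

theorem measurePreserving_coord {M : ℕ} (k : Fin (M + 2)) :
    MeasurePreserving (fun η : Fin (M + 2) → ℝ => η k) (sigma (M + 2)) (marginal M) := by
  refine ⟨measurable_pi_apply k, ?_⟩
  rw [← (measurePreserving_splice k).map_eq, Measure.map_map (measurable_pi_apply k)
    (continuous_splice k).measurable]
  have : (fun η : Fin (M + 2) → ℝ => η k) ∘ splice k = Prod.fst := by ext p; simp
  rw [this]
  exact measurePreserving_fst.map_eq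

theorem memLp_marginal_of_continuous {M : ℕ} {g : ℝ → ℝ} (hg : Continuous g) :
    MemLp g 2 (marginal M) :=
  (memLp_top_of_continuous_of_ae_mem (isCompact_Icc_marginal M) (ae_mem_marginal M)
    hg).mono_exponent le_top

/-- A polynomial as an element of `L²` of the one-coordinate law. -/
noncomputable def polyLp (M : ℕ) (p : ℝ[X]) : Lp ℝ 2 (marginal M) :=
  (memLp_marginal_of_continuous p.continuous).toLp (fun t => p.eval t)

theorem denseRange_polyLp (M : ℕ) : DenseRange (polyLp M) := by
  have hd := BoundedContinuousFunction.toLp_denseRange (p := 2) ℝ (marginal M) ℝ (by simp)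
  refine dense_iff_closure_eq.2 (Set.eq_univ_of_univ_subset ?_)
  rw [← hd.closure_eq]
  refine closure_minimal ?_ isClosed_closure
  rintro _ ⟨f, rfl⟩
  refine Metric.mem_closure_iff.2 fun ε hε => ?_
  obtain ⟨p, hp⟩ := exists_polynomial_near_of_continuousOn 0 (M + 2 : ℝ) f
    f.continuous.continuousOn (ε / 2) (by positivity)
  refine ⟨_, ⟨p, rfl⟩, ?_⟩
  rw [dist_eq_norm]
  refine lt_of_le_of_lt (Lp.norm_le_of_ae_bound (C := ε / 2) (by positivity) ?_) ?_
  · filter_upwards [Lp.coeFn_sub (BoundedContinuousFunction.toLp 2 (marginal M) ℝ f) (polyLp M p),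
      BoundedContinuousFunction.coeFn_toLp 2 (marginal M) ℝ f,
      (memLp_marginal_of_continuous p.continuous).coeFn_toLp, ae_mem_marginal M] with t h1 h2 h3 h4
    rw [h1, Pi.sub_apply, h2, polyLp, h3, Real.norm_eq_abs, abs_sub_comm]
    exact (hp t h4).le
  · simp [measureUnivNNReal]
    linarith

/-- Subtraction of the mean. -/
noncomputable def center (M : ℕ) (x : Lp ℝ 2 (marginal M)) : Lp ℝ 2 (marginal M) :=
  x - ⟪polyLp M 1, x⟫_ℝ • polyLp M 1

theorem inner_polyLp_one {M : ℕ} {g : ℝ → ℝ} (hg : MemLp g 2 (marginal M)) :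
    ⟪polyLp M 1, hg.toLp g⟫_ℝ = ∫ t, g t ∂marginal M := by
  rw [L2.inner_def]
  refine integral_congr_ae ?_
  filter_upwards [hg.coeFn_toLp,
    (memLp_marginal_of_continuous (1 : ℝ[X]).continuous).coeFn_toLp] with t h1 h2
  rw [h1, polyLp, h2]
  simp

/-- A function of one coordinate, as an element of `L²` of the flat Dirichlet law. -/
noncomputable def coordLp {M : ℕ} (k : Fin (M + 2)) :
    Lp ℝ 2 (marginal M) →ₗᵢ[ℝ] Lp ℝ 2 (sigma (M + 2)) :=
  Lp.compMeasurePreservingₗᵢ ℝ (fun η => η k) (measurePreserving_coord k)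

theorem coordLp_toLp {M : ℕ} (k : Fin (M + 2)) {g : ℝ → ℝ} (hg : MemLp g 2 (marginal M)) :
    coordLp k (hg.toLp g) =ᵐ[sigma (M + 2)] fun η => g (η k) := by
  have h1 := Lp.coeFn_compMeasurePreserving (hg.toLp g) (measurePreserving_coord k)
  have h2 := (measurePreserving_coord k).quasiMeasurePreserving.ae hg.coeFn_toLp
  filter_upwards [h1, h2] with η h1 h2
  exact h1.trans h2

theorem norm_sq_sum_coordLp {M : ℕ} {g : Fin (M + 2) → ℝ → ℝ}
    (hg : ∀ k, MemLp (g k) 2 (marginal M)) :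
    ‖∑ k, coordLp k ((hg k).toLp (g k))‖ ^ 2 =
      ∫ η, (∑ k, g k (η k)) ^ 2 ∂sigma (M + 2) := by
  apply norm_sq_eq_integral
  have h1 := coeFn_sum_Lp Finset.univ (fun k => coordLp k ((hg k).toLp (g k)))
  have h2 : ∀ᵐ η ∂sigma (M + 2), ∀ k, coordLp k ((hg k).toLp (g k)) η = g k (η k) :=
    ae_all_iff.2 fun k => coordLp_toLp k (hg k)
  filter_upwards [h1, h2] with η h1 h2
  rw [h1, Finset.sum_apply]
  exact Finset.sum_congr rfl fun k _ => h2 k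

theorem norm_sq_toLp {M : ℕ} (k : Fin (M + 2)) {g : ℝ → ℝ} (hg : MemLp g 2 (marginal M)) :
    ‖hg.toLp g‖ ^ 2 = ∫ η, g (η k) ^ 2 ∂sigma (M + 2) := by
  rw [← (coordLp k).norm_map]
  exact norm_sq_eq_integral _ (coordLp_toLp k hg)

theorem center_polyLp (M : ℕ) (p : ℝ[X]) : center M (polyLp M p) =
    polyLp M (p - Polynomial.C (∫ t, p.eval t ∂marginal M)) := by
  have h : ⟪polyLp M 1, polyLp M p⟫_ℝ = ∫ t, p.eval t ∂marginal M := inner_polyLp_one _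
  rw [center, h]
  apply Lp.ext
  have hc := fun q : ℝ[X] => (memLp_marginal_of_continuous (M := M) q.continuous).coeFn_toLp
  filter_upwards [Lp.coeFn_sub (polyLp M p) ((∫ t, p.eval t ∂marginal M) • polyLp M 1),
    Lp.coeFn_smul (∫ t, p.eval t ∂marginal M) (polyLp M 1), hc p, hc 1,
    hc (p - Polynomial.C (∫ t, p.eval t ∂marginal M))] with t h1 h2 h3 h4 h5
  rw [h1, Pi.sub_apply, h2, Pi.smul_apply]
  simp only [polyLp]
  rw [h3, h4, h5]
  simp

/-- Both sides are continuous in `x` and the inequality holds on the dense set of polynomial tuples.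
Centering is built into the statement, so the mean-zero constraint need not survive approximation.
-/
theorem norm_sq_sum_center_le (M : ℕ) (x : Fin (M + 2) → Lp ℝ 2 (marginal M)) :
    ‖∑ k, coordLp k (center M (x k))‖ ^ 2 ≤
      (1 + 2 / (M + 2 : ℝ)) * ∑ k, ‖center M (x k)‖ ^ 2 := by
  have hcont : Continuous (center M) := by unfold center; fun_prop
  have hclosed : IsClosed {x : Fin (M + 2) → Lp ℝ 2 (marginal M) |
      ‖∑ k, coordLp k (center M (x k))‖ ^ 2 ≤
        (1 + 2 / (M + 2 : ℝ)) * ∑ k, ‖center M (x k)‖ ^ 2} := by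
    refine isClosed_le ?_ ?_
    · refine (Continuous.norm (continuous_finsetSum _ fun k _ => ?_)).pow 2
      exact (coordLp k).continuous.comp (hcont.comp (continuous_apply k))
    · refine continuous_const.mul (continuous_finsetSum _ fun k _ => ?_)
      exact (hcont.comp (continuous_apply k)).norm.pow 2
  have hdense : Dense (Set.univ.pi fun _ : Fin (M + 2) => Set.range (polyLp M)) :=
    dense_pi _ fun _ _ => denseRange_polyLp M
  refine hclosed.closure_subset_iff.2 ?_ (hdense x)
  intro y hy
  choose p hp using fun k => hy k (Set.mem_univ k)
  obtain rfl : (fun k => polyLp M (p k)) = y := funext hp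
  simp only [Set.mem_ofPred_eq, center_polyLp]
  have key := integral_sq_sum_eval_le M
    (fun k => p k - Polynomial.C (∫ t, (p k).eval t ∂marginal M)) (fun k => by
      simp only [Polynomial.eval_sub, Polynomial.eval_C]
      rw [integral_sub (integrable_marginal_of_continuous (by fun_prop)) (integrable_const _)]
      simp)
  simp only [polyLp]
  rw [norm_sq_sum_coordLp]
  refine key.trans (le_of_eq ?_)
  congr 1
  exact Finset.sum_congr rfl fun k _ => (norm_sq_toLp k (memLp_marginal_of_continuous
    (Polynomial.continuous _))).symm

theorem integral_sq_sum_coord_le (M : ℕ) {g : Fin (M + 2) → ℝ → ℝ}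
    (hg : ∀ k, MemLp (g k) 2 (marginal M)) (h0 : ∀ k, ∫ t, g k t ∂marginal M = 0) :
    ∫ η, (∑ k, g k (η k)) ^ 2 ∂sigma (M + 2) ≤
      (1 + 2 / (M + 2 : ℝ)) * ∑ k, ∫ η, g k (η k) ^ 2 ∂sigma (M + 2) := by
  have h := norm_sq_sum_center_le M fun k => (hg k).toLp (g k)
  have hc : ∀ k, center M ((hg k).toLp (g k)) = (hg k).toLp (g k) := fun k => by
    rw [center, inner_polyLp_one, h0, zero_smul, sub_zero]
  simp_rw [hc] at h
  rw [norm_sq_sum_coordLp] at h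
  refine h.trans (le_of_eq ?_)
  congr 1
  exact Finset.sum_congr rfl fun k _ => norm_sq_toLp k _

theorem integral_sub_mul_sq {X : Type*} [MeasurableSpace X] {μ : Measure X} {f u : X → ℝ}
    (hf : MemLp f 2 μ) (hu : MemLp u 2 μ) (c : ℝ) :
    ∫ x, (f x - c * u x) ^ 2 ∂μ =
      ∫ x, f x ^ 2 ∂μ - 2 * c * ∫ x, f x * u x ∂μ + c ^ 2 * ∫ x, u x ^ 2 ∂μ := by
  have e : ∀ x, (f x - c * u x) ^ 2 = f x ^ 2 - 2 * c * (f x * u x) + c ^ 2 * u x ^ 2 :=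
    fun x => by ring
  have hfu : Integrable (fun x => 2 * c * (f x * u x)) μ := (hf.integrable_mul hu).const_mul _
  have hff : Integrable (fun x => f x ^ 2 - 2 * c * (f x * u x)) μ := hf.integrable_sq.sub hfu
  simp_rw [e]
  rw [integral_add hff (hu.integrable_sq.const_mul _), integral_sub hf.integrable_sq hfu,
    integral_const_mul, integral_const_mul]

/-- Duality: comparing `f` with a multiple of ∑ g_k turns the upper bound on ‖∑ g_k‖² into ∑ ‖g_k‖²
≤ (1 + 2/N)‖f‖². Of the projection property only ⟨f, g_k⟩ = ‖g_k‖² is used, so the lemma applies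
both to conditional expectations and to section means. -/
theorem integral_sq_le_sum_integral_sq_sub (M : ℕ) {f : (Fin (M + 2) → ℝ) → ℝ}
    (hf : MemLp f 2 (sigma (M + 2))) {g : Fin (M + 2) → ℝ → ℝ}
    (hg : ∀ k, MemLp (g k) 2 (marginal M)) (h0 : ∀ k, ∫ t, g k t ∂marginal M = 0)
    (hfg : ∀ k, ∫ η, f η * g k (η k) ∂sigma (M + 2) = ∫ η, g k (η k) ^ 2 ∂sigma (M + 2)) :
    (M + 1 - 2 / (M + 2 : ℝ)) * ∫ η, f η ^ 2 ∂sigma (M + 2) ≤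
      ∑ k, ∫ η, (f η - g k (η k)) ^ 2 ∂sigma (M + 2) := by
  have hu : ∀ k, MemLp (fun η : Fin (M + 2) → ℝ => g k (η k)) 2 (sigma (M + 2)) := fun k =>
    (hg k).comp_measurePreserving (measurePreserving_coord k)
  have hS : MemLp (fun η : Fin (M + 2) → ℝ => ∑ k, g k (η k)) 2 (sigma (M + 2)) :=
    memLp_finsetSum _ fun k _ => hu k
  have hfu : ∀ k, Integrable (fun η => f η * g k (η k)) (sigma (M + 2)) :=
    fun k => hf.integrable_mul (hu k)
  have hA := integral_sq_sum_coord_le M hg h0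
  set F := ∫ η, f η ^ 2 ∂sigma (M + 2) with hF
  set A := ∑ k, ∫ η, g k (η k) ^ 2 ∂sigma (M + 2) with hAdef
  have h1 : ∑ k, ∫ η, (f η - g k (η k)) ^ 2 ∂sigma (M + 2) = (M + 2) * F - A := by
    have : ∀ k, ∫ η, (f η - g k (η k)) ^ 2 ∂sigma (M + 2) =
        F - ∫ η, g k (η k) ^ 2 ∂sigma (M + 2) := by
      intro k
      have := integral_sub_mul_sq hf (hu k) 1
      simp only [one_mul, hfg] at this
      rw [this]
      ring
    simp_rw [this, Finset.sum_sub_distrib]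
    simp [hAdef]
  have h2 : ∫ η, f η * ∑ k, g k (η k) ∂sigma (M + 2) = A := by
    simp_rw [Finset.mul_sum]
    rw [integral_finsetSum _ fun k _ => hfu k]
    exact Finset.sum_congr rfl fun k _ => hfg k
  set c : ℝ := 1 + 2 / (M + 2 : ℝ) with hc
  have hc0 : 0 < c := by positivity
  -- The multiple `c⁻¹` minimizes the quadratic once ‖∑ g_k‖² is replaced by its bound `c * A`.
  have h3 : 0 ≤ F - 2 * c⁻¹ * A + c⁻¹ ^ 2 * ∫ η, (∑ k, g k (η k)) ^ 2 ∂sigma (M + 2) := by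
    have := integral_sub_mul_sq hf hS c⁻¹
    rw [h2] at this
    rw [← this]
    exact integral_nonneg fun _ => sq_nonneg _
  have h4 : A ≤ c * F := by
    have h5 : 0 ≤ F - 2 * c⁻¹ * A + c⁻¹ ^ 2 * (c * A) :=
      h3.trans (by gcongr)
    have h6 : F - 2 * c⁻¹ * A + c⁻¹ ^ 2 * (c * A) = F - c⁻¹ * A := by
      field_simp; ring
    rw [h6, sub_nonneg, inv_mul_le_iff₀ hc0] at h5
    exact h5
  rw [h1]
  linarith

end StochasticExchange

/-! ### The bound on Γ, and the pair terms of the Dirichlet form -/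

namespace StochasticExchange

theorem le_reducedForm {M : ℕ} {f : (Fin (M + 2) → ℝ) → ℝ} (hf : IsTrial (M + 2) f) :
    1 - 1 / ((M + 2 : ℕ) : ℝ) - 2 / ((M + 2 : ℕ) : ℝ) ^ 2 ≤ reducedForm 0 (M + 2) f := by
  obtain ⟨hf2, hf1, hf0⟩ := hf
  have hle : ∀ k : Fin (M + 2), MeasurableSpace.comap (fun η : Fin (M + 2) → ℝ => η k)
      inferInstance ≤ MeasurableSpace.pi := fun k => (measurable_pi_apply k).comap_le
  have hsm : ∀ k : Fin (M + 2), ∃ g : ℝ → ℝ, StronglyMeasurable g ∧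
      proj k f = g ∘ fun η : Fin (M + 2) → ℝ => η k := fun k =>
    stronglyMeasurable_condExp.exists_eq_measurable_comp
  choose g hgm hg using hsm
  have hg' : ∀ (k : Fin (M + 2)) (η : Fin (M + 2) → ℝ), g k (η k) = proj k f η := fun k η => by
    rw [hg]; rfl
  have hproj : ∀ k : Fin (M + 2), MemLp (proj k f) 2 (sigma (M + 2)) := fun k =>
    hf2.condExp one_le_two
  have hgL : ∀ k, MemLp (g k) 2 (marginal M) := fun k => by
    have := hproj k
    rw [hg] at this
    rw [← (measurePreserving_coord k).map_eq]
    exact (memLp_map_measure_iff (hgm k).aestronglyMeasurable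
      (measurable_pi_apply k).aemeasurable).2 this
  have key := integral_sq_le_sum_integral_sq_sub M hf2 hgL (fun k => by
    rw [← (measurePreserving_coord k).map_eq, integral_map (measurable_pi_apply k).aemeasurable
      (hgm k).aestronglyMeasurable]
    simp_rw [hg']
    rw [proj, integral_condExp (hle k), hf0]) (fun k => by
    simp_rw [hg']
    have hint : Integrable (f * proj k f) (sigma (M + 2)) := hf2.integrable_mul (hproj k)
    -- Pulling the measurable factor out of the conditional expectation gives ⟨f, P_k f⟩ = ‖P_k f‖².
    have h1 := condExp_mul_of_stronglyMeasurable_right (μ := sigma (M + 2))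
      (m := MeasurableSpace.comap (fun η : Fin (M + 2) → ℝ => η k) inferInstance)
      (f := f) (g := proj k f) stronglyMeasurable_condExp hint (hf2.integrable one_le_two)
    change ∫ η, (f * proj k f) η ∂sigma (M + 2) = _
    rw [← integral_condExp (hle k), integral_congr_ae h1]
    simp_rw [pow_two]
    rfl)
  simp_rw [hg', hf1] at key
  rw [reducedForm]
  simp only [weight, Real.rpow_zero, one_mul]
  refine le_trans (le_of_eq ?_) (mul_le_mul_of_nonneg_left key (by positivity))
  push_cast
  field_simp
  ring

/-- The contribution `⟨f, f - [f]^{(i,j)}⟩` of a pair to the Dirichlet form. -/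
noncomputable def pairForm {N : ℕ} (i j : Fin N) (f : (Fin N → ℝ) → ℝ) : ℝ :=
  ∫ η, f η * (f η - pairAverage i j f η) ∂sigma N

theorem integrable_mul_pairAverage {M : ℕ} {i j : Fin (M + 1)} (hij : i ≠ j)
    {f : (Fin (M + 1) → ℝ) → ℝ} (hf : MemLp f 2 (sigma (M + 1))) :
    Integrable (fun η => f η * pairAverage i j f η) (sigma (M + 1)) := by
  have h1 : MemLp (fun p : (Fin (M + 1) → ℝ) × ℝ => f p.1) 2 ((sigma (M + 1)).prod unif) :=
    hf.comp_measurePreserving measurePreserving_fst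
  have h2 : MemLp (fun p : (Fin (M + 1) → ℝ) × ℝ => f (exchange i j p.2 p.1)) 2
      ((sigma (M + 1)).prod unif) := hf.comp_measurePreserving (measurePreserving_exchange hij)
  have h3 := (h1.integrable_mul h2).integral_prod_left
  refine h3.congr ?_
  filter_upwards with η
  rw [pairAverage_eq, ← integral_const_mul]
  rfl

theorem integrable_mul_sub_pairAverage {M : ℕ} {i j : Fin (M + 1)} (hij : i ≠ j)
    {f : (Fin (M + 1) → ℝ) → ℝ} (hf : MemLp f 2 (sigma (M + 1))) :
    Integrable (fun η => f η * (f η - pairAverage i j f η)) (sigma (M + 1)) := by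
  simp_rw [mul_sub]
  exact (hf.integrable_mul hf).sub (integrable_mul_pairAverage hij hf)

theorem integral_pairAverage {M : ℕ} {i j : Fin (M + 1)} (hij : i ≠ j)
    {f : (Fin (M + 1) → ℝ) → ℝ} (hf : Integrable f (sigma (M + 1))) :
    ∫ η, pairAverage i j f η ∂sigma (M + 1) = ∫ η, f η ∂sigma (M + 1) := by
  have hmp := measurePreserving_exchange hij
  simp_rw [pairAverage_eq]
  rw [← integral_prod (fun p : (Fin (M + 1) → ℝ) × ℝ => f (exchange i j p.2 p.1))
    (hmp.integrable_comp_of_integrable hf), ← hmp.map_eq,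
    integral_map hmp.measurable.aemeasurable (by rw [hmp.map_eq]; exact hf.1), hmp.map_eq]

/-- With two particles the pair energy is the fixed total, so one exchange forgets the
configuration: the pair average is constant and, by invariance, equal to the mean. -/
theorem pairForm_two {f : (Fin 2 → ℝ) → ℝ} (hf : MemLp f 2 (sigma 2)) :
    pairForm 0 1 f = ∫ η, f η ^ 2 ∂sigma 2 - (∫ η, f η ∂sigma 2) ^ 2 := by
  have h01 : (0 : Fin (1 + 1)) ≠ 1 := by simp
  set c := ∫ α in (0 : ℝ)..1, f ![(1 - α) * 2, α * 2] with hc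
  have h1 : ∀ᵐ η ∂sigma (1 + 1), pairAverage 0 1 f η = c := by
    filter_upwards [ae_mem_stateSpace 1] with η hη
    have hs : η 0 + η 1 = 2 := by
      have := sum_eq_of_mem_stateSpace hη
      rw [Fin.sum_univ_two] at this
      exact_mod_cast this
    rw [pairAverage, hc]
    congr 1
    ext α
    congr 1
    ext k
    fin_cases k <;> simp [exchange, hs]
  have h2 : c = ∫ η, f η ∂sigma 2 := by
    rw [← integral_pairAverage (M := 1) h01 (hf.integrable one_le_two), integral_congr_ae h1]
    simp
  rw [pairForm]
  have h3 : ∫ η, f η * (f η - pairAverage 0 1 f η) ∂sigma 2 =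
      ∫ η, f η ^ 2 - c * f η ∂sigma 2 := by
    refine integral_congr_ae ?_
    filter_upwards [h1] with η h
    rw [h]; ring
  rw [h3, integral_sub hf.integrable_sq ((hf.integrable one_le_two).const_mul c),
    integral_const_mul, h2]
  ring

theorem pairForm_splice {M : ℕ} (k : Fin (M + 2)) {i j : Fin (M + 1)} (hij : i ≠ j)
    {f : (Fin (M + 2) → ℝ) → ℝ} (hf : MemLp f 2 (sigma (M + 2))) :
    Integrable (fun t => pairForm i j fun ξ => f (splice k (t, ξ))) (marginal M) ∧
      ∫ t, pairForm i j (fun ξ => f (splice k (t, ξ))) ∂marginal M =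
        pairForm (k.succAbove i) (k.succAbove j) f := by
  have hmp := measurePreserving_splice k
  have hij' : k.succAbove i ≠ k.succAbove j := fun h => hij (Fin.succAbove_right_injective h)
  have hint := integrable_mul_sub_pairAverage hij' hf
  have hint' := hmp.integrable_comp_of_integrable hint
  have e : ∀ t ξ, f (splice k (t, ξ)) * (f (splice k (t, ξ)) -
      pairAverage (k.succAbove i) (k.succAbove j) f (splice k (t, ξ))) =
      f (splice k (t, ξ)) * (f (splice k (t, ξ)) -
        pairAverage i j (fun ξ => f (splice k (t, ξ))) ξ) := fun t ξ => by
    rw [pairAverage_splice]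
  constructor
  · refine hint'.integral_prod_left.congr ?_
    filter_upwards with t
    simp only [Function.comp, e]
    rfl
  · have h1 := integral_prod _ hint'
    rw [pairForm, ← hmp.map_eq, integral_map hmp.measurable.aemeasurable
      (by rw [hmp.map_eq]; exact hint.1)]
    refine Eq.trans ?_ h1.symm
    simp only [Function.comp, e]
    rfl

theorem sum_Ioi_eq {N : ℕ} (G : Fin N → Fin N → ℝ) :
    ∑ i, ∑ j ∈ Finset.Ioi i, G i j = ∑ i, ∑ j, if i < j then G i j else 0 := by
  refine Finset.sum_congr rfl fun i _ => ?_
  rw [← Finset.sum_filter]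
  congr 1
  ext j; simp

/-- A pair avoids `k` for all but two of the M + 2 choices of `k`. -/
theorem sum_sum_Ioi_succAbove {M : ℕ} (G : Fin (M + 2) → Fin (M + 2) → ℝ) :
    ∑ k : Fin (M + 2), ∑ i, ∑ j ∈ Finset.Ioi i, G (k.succAbove i) (k.succAbove j) =
      M * ∑ i, ∑ j ∈ Finset.Ioi i, G i j := by
  set H : Fin (M + 2) → Fin (M + 2) → ℝ := fun i j => if i < j then G i j else 0 with hH
  have h1 : ∀ k : Fin (M + 2), ∑ i, ∑ j ∈ Finset.Ioi i, G (k.succAbove i) (k.succAbove j) =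
      ∑ i, ∑ j, H i j - ∑ j, H k j - ∑ i, H i k := by
    intro k
    rw [sum_Ioi_eq fun i j => G (k.succAbove i) (k.succAbove j)]
    have h2 : ∀ i j : Fin (M + 1), (if i < j then G (k.succAbove i) (k.succAbove j) else 0) =
        H (k.succAbove i) (k.succAbove j) := fun i j => by
      simp [hH, Fin.succAbove_lt_succAbove_iff]
    simp_rw [h2]
    have hkk : H k k = 0 := by simp [hH]
    rw [Fin.sum_univ_succAbove (fun i => ∑ j, H i j) k,
      Fin.sum_univ_succAbove (fun i => H i k) k, hkk]
    have h3 : ∀ i, ∑ j, H (k.succAbove i) j =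
        H (k.succAbove i) k + ∑ j, H (k.succAbove i) (k.succAbove j) := fun i =>
      Fin.sum_univ_succAbove _ k
    simp_rw [h3, Finset.sum_add_distrib]
    ring
  simp_rw [h1, Finset.sum_sub_distrib]
  rw [Finset.sum_comm (f := fun k i => H i k), sum_Ioi_eq]
  simp
  ring

theorem two_mul_sum_Ioi {N : ℕ} {G : Fin N → Fin N → ℝ} (hG : ∀ i j, G i j = G j i) :
    2 * ∑ i, ∑ j ∈ Finset.Ioi i, G i j = ∑ i, ∑ j, G i j - ∑ i, G i i := by
  have h1 : ∑ i, ∑ j, (if i < j then G i j else 0) = ∑ i, ∑ j, if j < i then G i j else 0 := by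
    rw [Finset.sum_comm]
    simp_rw [hG]
  have h2 : ∑ i, G i i = ∑ i, ∑ j, if i = j then G i j else 0 := by simp
  rw [two_mul, sum_Ioi_eq]
  nth_rewrite 2 [h1]
  rw [h2, eq_sub_iff_add_eq]
  simp_rw [← Finset.sum_add_distrib]
  refine Finset.sum_congr rfl fun i _ => Finset.sum_congr rfl fun j _ => ?_
  rcases lt_trichotomy i j with h | h | h
  · simp [h, h.not_gt, h.ne]
  · simp [h]
  · simp [h, h.not_gt, h.ne']

end StochasticExchange

/-! ### Induction on the number of particles -/

namespace StochasticExchange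

theorem integral_sub_const_sq {X : Type*} [MeasurableSpace X] {μ : Measure X}
    [IsProbabilityMeasure μ] {f : X → ℝ} (hf : MemLp f 2 μ) (c : ℝ) :
    ∫ x, (f x - c) ^ 2 ∂μ = ∫ x, f x ^ 2 ∂μ - 2 * c * ∫ x, f x ∂μ + c ^ 2 := by
  have := integral_sub_mul_sq hf (memLp_const (1 : ℝ)) c
  simpa using this

/-- The average of `f` over the other coordinates, as a function of the `k`-th coordinate. -/
noncomputable def sectionMean {M : ℕ} (k : Fin (M + 2)) (f : (Fin (M + 2) → ℝ) → ℝ) (t : ℝ) : ℝ :=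
  ∫ ξ, f (splice k (t, ξ)) ∂sigma (M + 1)

section sections

variable {M : ℕ} (k : Fin (M + 2)) {f : (Fin (M + 2) → ℝ) → ℝ}

theorem integral_splice {F : (Fin (M + 2) → ℝ) → ℝ} (hF : Integrable F (sigma (M + 2))) :
    ∫ η, F η ∂sigma (M + 2) = ∫ t, ∫ ξ, F (splice k (t, ξ)) ∂sigma (M + 1) ∂marginal M := by
  have hmp := measurePreserving_splice k
  rw [← integral_prod (fun p => F (splice k p)) (hmp.integrable_comp_of_integrable hF),
    ← hmp.map_eq, integral_map hmp.measurable.aemeasurable (by rw [hmp.map_eq]; exact hF.1)]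

theorem ae_memLp_splice (hf : MemLp f 2 (sigma (M + 2))) :
    ∀ᵐ t ∂marginal M, MemLp (fun ξ => f (splice k (t, ξ))) 2 (sigma (M + 1)) := by
  have hF := hf.comp_measurePreserving (measurePreserving_splice k)
  filter_upwards [hF.integrable_sq.prod_right_ae, hF.1.prodMk_left] with t h1 h2
  exact (memLp_two_iff_integrable_sq h2).2 h1

/-- Nonnegativity of the variance on each section bounds the squared mean by the second moment,
which is integrable by Fubini. -/
theorem memLp_sectionMean (hf : MemLp f 2 (sigma (M + 2))) :
    MemLp (sectionMean k f) 2 (marginal M) := by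
  have hF := hf.comp_measurePreserving (measurePreserving_splice k)
  have hm : AEStronglyMeasurable (sectionMean k f) (marginal M) := hF.1.integral_prod_right'
  refine (memLp_two_iff_integrable_sq hm).2 ?_
  refine hF.integrable_sq.integral_prod_left.mono' (hm.pow 2) ?_
  filter_upwards [ae_memLp_splice k hf] with t ht
  have h1 := integral_sub_const_sq ht (sectionMean k f t)
  have h2 : 0 ≤ ∫ ξ, (f (splice k (t, ξ)) - sectionMean k f t) ^ 2 ∂sigma (M + 1) :=
    integral_nonneg fun _ => sq_nonneg _
  have h3 : ∫ ξ, f (splice k (t, ξ)) ∂sigma (M + 1) = sectionMean k f t := rfl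
  rw [Real.norm_of_nonneg (sq_nonneg _)]
  simp only [Function.comp]
  rw [h3] at h1
  linarith

theorem memLp_sectionMean_comp (hf : MemLp f 2 (sigma (M + 2))) :
    MemLp (fun η : Fin (M + 2) → ℝ => sectionMean k f (η k)) 2 (sigma (M + 2)) :=
  (memLp_sectionMean k hf).comp_measurePreserving (measurePreserving_coord k)

theorem integral_sectionMean (hf : MemLp f 2 (sigma (M + 2))) :
    ∫ t, sectionMean k f t ∂marginal M = ∫ η, f η ∂sigma (M + 2) :=
  (integral_splice k (hf.integrable one_le_two)).symm

theorem integral_sectionMean_sq (hf : MemLp f 2 (sigma (M + 2))) :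
    ∫ η, sectionMean k f (η k) ^ 2 ∂sigma (M + 2) = ∫ t, sectionMean k f t ^ 2 ∂marginal M := by
  rw [integral_splice k (memLp_sectionMean_comp k hf).integrable_sq]
  simp

theorem integral_sectionMean_comp (hf : MemLp f 2 (sigma (M + 2))) :
    ∫ η, sectionMean k f (η k) ∂sigma (M + 2) = ∫ η, f η ∂sigma (M + 2) := by
  rw [integral_splice k ((memLp_sectionMean_comp k hf).integrable one_le_two),
    ← integral_sectionMean k hf]
  simp

theorem integral_mul_sectionMean (hf : MemLp f 2 (sigma (M + 2))) :
    ∫ η, f η * sectionMean k f (η k) ∂sigma (M + 2) =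
      ∫ t, sectionMean k f t ^ 2 ∂marginal M := by
  have hfu : Integrable (fun η => f η * sectionMean k f (η k)) (sigma (M + 2)) :=
    hf.integrable_mul (memLp_sectionMean_comp k hf)
  rw [integral_splice k hfu]
  simp only [splice_same, integral_mul_const, pow_two]
  rfl

/-- The right side is the integrated variance on the sections, the quantity to which the induction
hypothesis applies. With section means as an explicit version of P_k, no a.e. identification is
required. -/
theorem integral_sub_sectionMean_sq (hf : MemLp f 2 (sigma (M + 2))) :
    ∫ η, (f η - sectionMean k f (η k)) ^ 2 ∂sigma (M + 2) =
      ∫ t, (∫ ξ, f (splice k (t, ξ)) ^ 2 ∂sigma (M + 1) - sectionMean k f t ^ 2) ∂marginal M := by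
  have h := integral_sub_mul_sq hf (memLp_sectionMean_comp k hf) 1
  have hF := hf.comp_measurePreserving (measurePreserving_splice k)
  rw [integral_mul_sectionMean k hf, integral_sectionMean_sq k hf,
    integral_splice k hf.integrable_sq] at h
  simp only [one_mul] at h
  have hI : Integrable (fun t => ∫ ξ, f (splice k (t, ξ)) ^ 2 ∂sigma (M + 1)) (marginal M) :=
    hF.integrable_sq.integral_prod_left
  rw [h, integral_sub hI (memLp_sectionMean k hf).integrable_sq]
  ring

theorem variance_le_sum_sub_sectionMean (hf : MemLp f 2 (sigma (M + 2))) :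
    (M + 1 - 2 / (M + 2 : ℝ)) *
        (∫ η, f η ^ 2 ∂sigma (M + 2) - (∫ η, f η ∂sigma (M + 2)) ^ 2) ≤
      ∑ k, ∫ η, (f η - sectionMean k f (η k)) ^ 2 ∂sigma (M + 2) := by
  set m := ∫ η, f η ∂sigma (M + 2) with hm
  have key := integral_sq_le_sum_integral_sq_sub M (f := fun η => f η - m) (hf.sub (memLp_const m))
    (g := fun k t => sectionMean k f t - m)
    (fun k => (memLp_sectionMean k hf).sub (memLp_const m)) (fun k => by
      rw [integral_sub ((memLp_sectionMean k hf).integrable one_le_two) (integrable_const _),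
        integral_sectionMean k hf]
      simp [hm]) (fun k => by
      have hu := memLp_sectionMean_comp k hf
      have hfu : Integrable (fun η => f η * sectionMean k f (η k)) (sigma (M + 2)) :=
        hf.integrable_mul hu
      have hf1 := hf.integrable one_le_two
      have hu1 := hu.integrable one_le_two
      have e : ∀ η, (f η - m) * (sectionMean k f (η k) - m) =
          f η * sectionMean k f (η k) - (m * f η + m * sectionMean k f (η k)) + m ^ 2 :=
        fun η => by ring
      have hL : Integrable (fun η => m * f η + m * sectionMean k f (η k)) (sigma (M + 2)) :=
        (hf1.const_mul m).add (hu1.const_mul m)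
      have hA : Integrable (fun η => f η * sectionMean k f (η k) -
        (m * f η + m * sectionMean k f (η k))) (sigma (M + 2)) := hfu.sub hL
      simp_rw [e]
      rw [integral_sub_const_sq hu, integral_add hA (integrable_const _), integral_sub hfu hL,
        integral_add (hf1.const_mul m) (hu1.const_mul m), integral_const_mul,
        integral_const_mul, integral_mul_sectionMean k hf, integral_sectionMean_sq k hf,
        integral_sectionMean_comp k hf, ← hm]
      simp
      ring)
  have h1 : ∫ η, (f η - m) ^ 2 ∂sigma (M + 2) = ∫ η, f η ^ 2 ∂sigma (M + 2) - m ^ 2 := by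
    rw [integral_sub_const_sq hf, ← hm]
    ring
  rw [h1] at key
  simpa using key

end sections

theorem variance_le_sum_pairForm (n : ℕ) (f : (Fin (n + 2) → ℝ) → ℝ)
    (hf : MemLp f 2 (sigma (n + 2))) :
    (n + 3) / 3 * (∫ η, f η ^ 2 ∂sigma (n + 2) - (∫ η, f η ∂sigma (n + 2)) ^ 2) ≤
      ∑ i, ∑ j ∈ Finset.Ioi i, pairForm i j f := by
  induction n with
  | zero =>
    have h : ∑ i : Fin 2, ∑ j ∈ Finset.Ioi i, pairForm i j f = pairForm 0 1 f := by
      rw [Fin.sum_univ_two, show Finset.Ioi (0 : Fin 2) = {1} by rfl,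
        show Finset.Ioi (1 : Fin 2) = ∅ by rfl]
      simp
    have h2 := pairForm_two hf
    refine le_of_eq (Eq.trans ?_ (h2.symm.trans h.symm))
    norm_num
  | succ n ih =>
    have hij : ∀ {i j : Fin (n + 2)}, j ∈ Finset.Ioi i → i ≠ j := fun h =>
      (Finset.mem_Ioi.1 h).ne
    have h1 : ∀ k : Fin (n + 1 + 2),
        (n + 3) / 3 * ∫ η, (f η - sectionMean k f (η k)) ^ 2 ∂sigma (n + 1 + 2) ≤
          ∑ i, ∑ j ∈ Finset.Ioi i, pairForm (k.succAbove i) (k.succAbove j) f := by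
      intro k
      have hF := hf.comp_measurePreserving (measurePreserving_splice k)
      have hI : ∀ i : Fin (n + 2), ∀ j ∈ Finset.Ioi i, Integrable
          (fun t => pairForm i j fun ξ => f (splice k (t, ξ))) (marginal (n + 1)) :=
        fun i j h => (pairForm_splice k (hij h) hf).1
      rw [integral_sub_sectionMean_sq k hf, ← integral_const_mul,
        Finset.sum_congr rfl fun i _ => Finset.sum_congr rfl fun j h =>
          (pairForm_splice k (hij h) hf).2.symm,
        Finset.sum_congr rfl fun i _ => (integral_finsetSum _ (hI i)).symm,
        ← integral_finsetSum _ fun i _ => integrable_finsetSum _ (hI i)]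
      refine integral_mono_ae ?_
        (integrable_finsetSum _ fun i _ => integrable_finsetSum _ (hI i)) ?_
      · exact (hF.integrable_sq.integral_prod_left.sub
          (memLp_sectionMean k hf).integrable_sq).const_mul _
      · filter_upwards [ae_memLp_splice k hf] with t ht
        exact ih _ ht
    have h2 := Finset.sum_le_sum fun k (_ : k ∈ Finset.univ) => h1 k
    rw [sum_sum_Ioi_succAbove fun i j => pairForm i j f, ← Finset.mul_sum] at h2
    have h3 := variance_le_sum_sub_sectionMean hf
    have h4 := (mul_le_mul_of_nonneg_left h3 (show (0 : ℝ) ≤ (n + 3) / 3 by positivity)).trans h2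
    have h5 : (0 : ℝ) < (n + 1 : ℕ) := by positivity
    -- With N = n + 3, the recursion closes exactly: N/3 · (N - 1 - 2/N) = (N - 2)(N + 1)/3, and N -
    -- 2 cancels.
    refine le_of_mul_le_mul_left (le_trans (le_of_eq ?_) h4) h5
    have h6 : (n : ℝ) + 3 ≠ 0 := by positivity
    push_cast
    rw [show (n : ℝ) + 1 + 2 = n + 3 by ring]
    field_simp
    ring

theorem dirichletForm_zero_eq {M : ℕ} {f : (Fin (M + 2) → ℝ) → ℝ}
    (hf : MemLp f 2 (sigma (M + 2))) :
    dirichletForm 0 (M + 2) f =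
      2 / (M + 1) * ∑ i, ∑ j ∈ Finset.Ioi i, pairForm i j f := by
  have hK : ((M + 2 : ℕ) : ℝ) * (((M + 2).choose 2 : ℕ) : ℝ)⁻¹ = 2 / (M + 1) := by
    rw [Nat.cast_choose_two]
    have : (M : ℝ) + 1 ≠ 0 := by positivity
    push_cast
    rw [show (M : ℝ) + 2 - 1 = M + 1 by ring]
    field_simp
  have hI : ∀ i : Fin (M + 2), ∀ j ∈ Finset.Ioi i,
      Integrable (fun η => f η * (f η - pairAverage i j f η)) (sigma (M + 2)) :=
    fun i j h => integrable_mul_sub_pairAverage (Finset.mem_Ioi.1 h).ne hf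
  simp only [dirichletForm, generator, Real.rpow_zero, one_mul, hK]
  have e : ∀ η, f η * -(2 / ((M : ℝ) + 1) *
      ∑ i, ∑ j ∈ Finset.Ioi i, (f η - pairAverage i j f η)) =
      -(2 / ((M : ℝ) + 1) * ∑ i, ∑ j ∈ Finset.Ioi i, f η * (f η - pairAverage i j f η)) := by
    intro η
    simp_rw [← Finset.mul_sum]
    ring
  simp_rw [e]
  rw [integral_neg, neg_neg, integral_const_mul,
    integral_finsetSum _ fun i _ => integrable_finsetSum _ (hI i),
    Finset.sum_congr rfl fun i _ => integral_finsetSum _ (hI i)]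
  rfl

theorem le_dirichletForm {M : ℕ} {f : (Fin (M + 2) → ℝ) → ℝ} (hf : IsTrial (M + 2) f) :
    2 / 3 * ((((M + 2 : ℕ) : ℝ) + 1) / (((M + 2 : ℕ) : ℝ) - 1)) ≤ dirichletForm 0 (M + 2) f := by
  have h := variance_le_sum_pairForm M f hf.1
  rw [hf.2.1, hf.2.2] at h
  rw [dirichletForm_zero_eq hf.1]
  refine le_trans (le_of_eq ?_) (mul_le_mul_of_nonneg_left h (by positivity))
  push_cast
  rw [show (M : ℝ) + 2 - 1 = M + 1 by ring]
  have : (M : ℝ) + 1 ≠ 0 := by positivity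
  field_simp
  ring

end StochasticExchange

/-! ### The extremal function and the values of the gaps -/

namespace StochasticExchange
open scoped Nat

theorem integral_coord_sq {M : ℕ} (k : Fin (M + 2)) :
    ∫ η, η k ^ 2 ∂sigma (M + 2) = 2 * (M + 2) / (M + 3) := by
  rw [integral_comp_coord k (g := fun t => t ^ 2) (by fun_prop)]
  have := integral_pow_mul_sub_pow_marginal M 2 0
  simp only [pow_zero, mul_one, zero_add, add_zero] at this
  rw [this, show 2 + M + 1 = M + 1 + 1 + 1 by ring, Nat.factorial_succ (M + 1 + 1),
    Nat.factorial_succ (M + 1), Nat.factorial_succ M]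
  have : (M ! : ℝ) ≠ 0 := by exact_mod_cast Nat.factorial_ne_zero _
  push_cast
  simp only [Nat.factorial_two]
  field_simp
  ring

theorem factorial_add_five (M : ℕ) :
    ((M + 5)! : ℝ) = (M + 5) * (M + 4) * (M + 3) * (M + 2) * (M + 1)! := by
  rw [show M + 5 = M + 1 + 1 + 1 + 1 + 1 by ring, Nat.factorial_succ (M + 1 + 1 + 1 + 1),
    Nat.factorial_succ (M + 1 + 1 + 1), Nat.factorial_succ (M + 1 + 1),
    Nat.factorial_succ (M + 1)]
  push_cast
  ring

theorem integral_coord_sq_mul_sq {M : ℕ} {i j : Fin (M + 2)} (hij : i ≠ j) :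
    ∫ η, η i ^ 2 * η j ^ 2 ∂sigma (M + 2) =
      4 * (M + 2) ^ 3 / ((M + 3) * (M + 4) * (M + 5)) := by
  rw [integral_pow_mul_pow_sigma hij, show 2 + 2 + M + 1 = M + 5 by ring, factorial_add_five]
  have : ((M + 1)! : ℝ) ≠ 0 := by exact_mod_cast Nat.factorial_ne_zero _
  push_cast
  simp only [Nat.factorial_two]
  field_simp
  ring

theorem integral_coord_pow_four {M : ℕ} (k : Fin (M + 2)) :
    ∫ η, η k ^ 2 * η k ^ 2 ∂sigma (M + 2) =
      24 * (M + 2) ^ 3 / ((M + 3) * (M + 4) * (M + 5)) := by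
  rw [integral_comp_coord k (g := fun t => t ^ 2 * t ^ 2) (by fun_prop)]
  have := integral_pow_mul_sub_pow_marginal M 4 0
  simp only [pow_zero, mul_one, zero_add, add_zero] at this
  simp_rw [← pow_add]
  rw [this, show 4 + M + 1 = M + 5 by ring, factorial_add_five, Nat.factorial_succ M]
  have : (M ! : ℝ) ≠ 0 := by exact_mod_cast Nat.factorial_ne_zero _
  push_cast
  rw [show ((4 ! : ℕ) : ℝ) = 24 by norm_num [Nat.factorial]]
  field_simp

/-- The centered sum of the squared energies. -/
noncomputable def squareSum (M : ℕ) (η : Fin (M + 2) → ℝ) : ℝ :=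
  ∑ k, η k ^ 2 - 2 * (M + 2) ^ 2 / (M + 3)

theorem continuous_squareSum (M : ℕ) : Continuous (squareSum M) := by
  unfold squareSum; fun_prop

theorem integral_squareSum (M : ℕ) : ∫ η, squareSum M η ∂sigma (M + 2) = 0 := by
  unfold squareSum
  rw [integral_sub (integrable_of_continuous (by fun_prop)) (integrable_const _),
    integral_finsetSum _ fun k _ => integrable_of_continuous (by fun_prop)]
  simp_rw [integral_coord_sq]
  simp
  ring

/-- A positive correlation with one squared energy certifies that the candidate is not a.e. zero,
without evaluating its variance. -/
theorem integral_squareSum_mul_sq_pos (M : ℕ) :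
    0 < ∫ η, squareSum M η * η 0 ^ 2 ∂sigma (M + 2) := by
  have h : ∫ η, squareSum M η * η 0 ^ 2 ∂sigma (M + 2) =
      4 * (M + 2) ^ 3 * (M + 1) / ((M + 3) ^ 2 * (M + 4) * (M + 5)) := by
    simp only [squareSum, sub_mul, Finset.sum_mul]
    rw [integral_sub (integrable_of_continuous (by fun_prop))
      (integrable_of_continuous (by fun_prop)), integral_const_mul, integral_coord_sq,
      integral_finsetSum _ fun k _ => integrable_of_continuous (by fun_prop), Fin.sum_univ_succ,
      integral_coord_pow_four,
      Finset.sum_congr rfl fun l _ => integral_coord_sq_mul_sq (Fin.succ_ne_zero l)]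
    simp
    field_simp
    ring
  rw [h]
  positivity

theorem integral_squareSum_sq_pos (M : ℕ) : 0 < ∫ η, squareSum M η ^ 2 ∂sigma (M + 2) := by
  refine lt_of_le_of_ne (integral_nonneg fun _ => sq_nonneg _) fun h => ?_
  have hc := continuous_squareSum M
  have h1 := (integral_eq_zero_iff_of_nonneg (fun η => sq_nonneg (squareSum M η))
    (integrable_of_continuous (by fun_prop))).1 h.symm
  have h2 : ∫ η, squareSum M η * η 0 ^ 2 ∂sigma (M + 2) = 0 := by
    rw [← integral_zero (Fin (M + 2) → ℝ) ℝ]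
    refine integral_congr_ae ?_
    filter_upwards [h1] with η hη
    have : squareSum M η = 0 := pow_eq_zero_iff two_ne_zero |>.1 hη
    simp [this]
  exact (integral_squareSum_mul_sq_pos M).ne' h2

theorem pairAverage_squareSum {M : ℕ} {i j : Fin (M + 2)} (hij : i ≠ j) (s : ℝ)
    (η : Fin (M + 2) → ℝ) :
    s * squareSum M η - pairAverage i j (fun η => s * squareSum M η) η =
      s * (1 / 3 * (η i ^ 2 + η j ^ 2) - 4 / 3 * (η i * η j)) := by
  set R := ∑ k ∈ (Finset.univ.erase i).erase j, η k ^ 2 with hR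
  have h1 : ∀ α, squareSum M (exchange i j α η) =
      -- This is (1 - α)² + α², of mean 2/3; the power `α ^ 1` lets `integral_pow` apply.
      (1 - 2 * α ^ 1 + 2 * α ^ 2) * (η i + η j) ^ 2 + (R - 2 * (M + 2) ^ 2 / (M + 3)) := by
    intro α
    rw [squareSum, sum_eq_add_add_sum_erase hij, exchange_left, exchange_right α η hij,
      Finset.sum_congr rfl fun k hk => by rw [exchange_of_mem α η hk], ← hR]
    ring
  have h2 : ∫ α in (0 : ℝ)..1, squareSum M (exchange i j α η) =
      2 / 3 * (η i + η j) ^ 2 + (R - 2 * (M + 2) ^ 2 / (M + 3)) := by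
    simp_rw [h1]
    rw [intervalIntegral.integral_add (Continuous.intervalIntegrable (by fun_prop) _ _)
      (Continuous.intervalIntegrable (by fun_prop) _ _), intervalIntegral.integral_mul_const,
      intervalIntegral.integral_add (Continuous.intervalIntegrable (by fun_prop) _ _)
      (Continuous.intervalIntegrable (by fun_prop) _ _),
      intervalIntegral.integral_sub (Continuous.intervalIntegrable (by fun_prop) _ _)
      (Continuous.intervalIntegrable (by fun_prop) _ _)]
    simp only [intervalIntegral.integral_const_mul, integral_pow,
      intervalIntegral.integral_const]
    norm_num
  rw [pairAverage, intervalIntegral.integral_const_mul, h2, squareSum,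
    sum_eq_add_add_sum_erase hij, ← hR]
  ring

/-- The cross terms η_i η_j sum to a function of ∑ η_k² because the total energy is fixed. The
resulting constant is the one removed by centering, so an eigenfunction remains. -/
theorem generator_squareSum {M : ℕ} (s : ℝ) {η : Fin (M + 2) → ℝ} (hη : η ∈ stateSpace (M + 2)) :
    ∑ i, ∑ j ∈ Finset.Ioi i,
      (s * squareSum M η - pairAverage i j (fun η => s * squareSum M η) η) =
      (M + 3) / 3 * (s * squareSum M η) := by
  have hs : ∑ k, η k = (M + 2 : ℝ) := by
    have := sum_eq_of_mem_stateSpace hη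
    push_cast at this
    exact this
  have hpa : ∀ i : Fin (M + 2), ∀ j ∈ Finset.Ioi i,
      s * squareSum M η - pairAverage i j (fun η => s * squareSum M η) η =
      s * (1 / 3 * (η i ^ 2 + η j ^ 2) - 4 / 3 * (η i * η j)) := fun i j h =>
    pairAverage_squareSum (Finset.mem_Ioi.1 h).ne s η
  rw [Finset.sum_congr rfl fun i _ => Finset.sum_congr rfl (hpa i)]
  have h := two_mul_sum_Ioi
    (G := fun i j => s * (1 / 3 * (η i ^ 2 + η j ^ 2) - 4 / 3 * (η i * η j)))
    (fun i j => by ring)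
  have h1 : ∑ i, ∑ j, s * (1 / 3 * (η i ^ 2 + η j ^ 2) - 4 / 3 * (η i * η j)) =
      s * (2 / 3 * (M + 2) * ∑ k, η k ^ 2 - 4 / 3 * (M + 2) ^ 2) := by
    have hi : ∀ i, ∑ j, s * (1 / 3 * (η i ^ 2 + η j ^ 2) - 4 / 3 * (η i * η j)) =
        s * (1 / 3 * (M + 2)) * η i ^ 2 + s * (1 / 3 * ∑ k, η k ^ 2) -
          s * (4 / 3 * (M + 2)) * η i := by
      intro i
      rw [← Finset.mul_sum, Finset.sum_sub_distrib, ← Finset.mul_sum, ← Finset.mul_sum,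
        ← Finset.mul_sum, hs, Finset.sum_add_distrib, Finset.sum_const, Finset.card_univ,
        Fintype.card_fin, nsmul_eq_mul]
      push_cast
      ring
    simp_rw [hi]
    rw [Finset.sum_sub_distrib, Finset.sum_add_distrib, ← Finset.mul_sum, ← Finset.mul_sum,
      ← Finset.mul_sum, ← Finset.mul_sum, hs, Finset.sum_const, Finset.card_univ, Fintype.card_fin, nsmul_eq_mul]
    push_cast
    ring
  have h2 : ∑ i, s * (1 / 3 * (η i ^ 2 + η i ^ 2) - 4 / 3 * (η i * η i)) =
      -(s * (2 / 3 * ∑ k, η k ^ 2)) := by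
    rw [Finset.mul_sum, Finset.mul_sum, ← Finset.sum_neg_distrib]
    exact Finset.sum_congr rfl fun i _ => by ring
  rw [h1, h2] at h
  have h3 : (M : ℝ) + 3 ≠ 0 := by positivity
  have e : (M + 3 : ℝ) / 3 * (s * squareSum M η) =
      s * ((M + 3) / 3 * ∑ k, η k ^ 2 - 2 / 3 * (M + 2) ^ 2) := by
    rw [squareSum]
    field_simp
  rw [e]
  linarith

theorem exists_isTrial_dirichletForm_eq (M : ℕ) : ∃ f, IsTrial (M + 2) f ∧
    dirichletForm 0 (M + 2) f = 2 / 3 * ((((M + 2 : ℕ) : ℝ) + 1) / (((M + 2 : ℕ) : ℝ) - 1)) := by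
  set V := ∫ η, squareSum M η ^ 2 ∂sigma (M + 2) with hV
  have hVpos : 0 < V := integral_squareSum_sq_pos M
  set s := (√V)⁻¹ with hs
  have hc := continuous_squareSum M
  have hmem : MemLp (fun η => s * squareSum M η) 2 (sigma (M + 2)) :=
    memLp_of_continuous (by fun_prop) 2
  have hnorm : ∫ η, (s * squareSum M η) ^ 2 ∂sigma (M + 2) = 1 := by
    simp_rw [mul_pow]
    rw [integral_const_mul, ← hV, hs, inv_pow, Real.sq_sqrt hVpos.le, inv_mul_cancel₀ hVpos.ne']
  refine ⟨_, ⟨hmem, hnorm, ?_⟩, ?_⟩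
  · rw [integral_const_mul, integral_squareSum, mul_zero]
  · have hI : ∀ i : Fin (M + 2), ∀ j ∈ Finset.Ioi i, Integrable (fun η => s * squareSum M η *
        (s * squareSum M η - pairAverage i j (fun η => s * squareSum M η) η)) (sigma (M + 2)) :=
      fun i j h => integrable_mul_sub_pairAverage (Finset.mem_Ioi.1 h).ne hmem
    have h1 : ∑ i, ∑ j ∈ Finset.Ioi i, pairForm i j (fun η => s * squareSum M η) =
        (M + 3) / 3 := by
      simp only [pairForm]
      rw [Finset.sum_congr rfl fun i _ => (integral_finsetSum _ (hI i)).symm,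
        ← integral_finsetSum _ fun i _ => integrable_finsetSum _ (hI i)]
      have h2 : ∀ᵐ η ∂sigma (M + 2), ∑ i, ∑ j ∈ Finset.Ioi i, s * squareSum M η *
          (s * squareSum M η - pairAverage i j (fun η => s * squareSum M η) η) =
          (M + 3) / 3 * (s * squareSum M η) ^ 2 := by
        filter_upwards [ae_mem_stateSpace (M + 1)] with η hη
        simp_rw [← Finset.mul_sum]
        rw [generator_squareSum s hη]
        ring
      rw [integral_congr_ae h2, integral_const_mul, hnorm, mul_one]
    rw [dirichletForm_zero_eq hmem, h1]
    push_cast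
    rw [show (M : ℝ) + 2 - 1 = M + 1 by ring]
    have : (M : ℝ) + 1 ≠ 0 := by positivity
    field_simp
    ring

theorem Delta_zero_eq (M : ℕ) : Delta 0 (M + 2) =
    2 / 3 * ((((M + 2 : ℕ) : ℝ) + 1) / (((M + 2 : ℕ) : ℝ) - 1)) := by
  refine IsLeast.csInf_eq ⟨exists_isTrial_dirichletForm_eq M, ?_⟩
  rintro _ ⟨f, hf, rfl⟩
  exact le_dirichletForm hf

theorem le_Gam_zero (M : ℕ) :
    1 - 1 / ((M + 2 : ℕ) : ℝ) - 2 / ((M + 2 : ℕ) : ℝ) ^ 2 ≤ Gam 0 (M + 2) := by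
  -- A trial function must exist: the real infimum of the empty set would be 0 by convention.
  obtain ⟨f, hf, -⟩ := exists_isTrial_dirichletForm_eq M
  refine le_csInf ⟨_, f, hf, rfl⟩ ?_
  rintro _ ⟨f, hf, rfl⟩
  exact le_reducedForm hf

end StochasticExchange

theorem theorem4p1 :
    (∀ N : ℕ, 3 ≤ N →
      0 < StochasticExchange.Gam 0 N ∧
      1 - 1 / (N : ℝ) - 2 / (N : ℝ) ^ 2 ≤ StochasticExchange.Gam 0 N ∧
      2 / 3 * (((N : ℝ) + 1) / ((N : ℝ) - 1)) ≤ StochasticExchange.Delta 0 N ∧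
      StochasticExchange.Delta 0 N = 2 / 3 * (((N : ℝ) + 1) / ((N : ℝ) - 1))) ∧
    ∃ c : ℝ, 0 < c ∧ ∀ N : ℕ, 3 ≤ N → c ≤ StochasticExchange.Delta 0 N := by
  have hD : ∀ N : ℕ, 3 ≤ N →
      StochasticExchange.Delta 0 N = 2 / 3 * (((N : ℝ) + 1) / ((N : ℝ) - 1)) := by
    intro N hN
    obtain ⟨M, rfl⟩ := Nat.exists_eq_add_of_le' (le_trans (by norm_num : 2 ≤ 3) hN)
    exact StochasticExchange.Delta_zero_eq M
  refine ⟨fun N hN => ?_, 2 / 3, by norm_num, fun N hN => ?_⟩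
  · have hG : 1 - 1 / (N : ℝ) - 2 / (N : ℝ) ^ 2 ≤ StochasticExchange.Gam 0 N := by
      obtain ⟨M, rfl⟩ := Nat.exists_eq_add_of_le' (le_trans (by norm_num : 2 ≤ 3) hN)
      exact StochasticExchange.le_Gam_zero M
    refine ⟨lt_of_lt_of_le ?_ hG, hG, (hD N hN).ge, hD N hN⟩
    have h3 : (3 : ℝ) ≤ N := by exact_mod_cast hN
    -- The factor N - 2 is what requires N ≥ 3 for strict positivity.
    have e : 1 - 1 / (N : ℝ) - 2 / (N : ℝ) ^ 2 = (N - 2) * (N + 1) / N ^ 2 := by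
      field_simp
      ring
    rw [e]
    exact div_pos (mul_pos (by linarith) (by linarith)) (by positivity)
  · rw [hD N hN]
    have h3 : (3 : ℝ) ≤ N := by exact_mod_cast hN
    have : 1 ≤ ((N : ℝ) + 1) / ((N : ℝ) - 1) := by
      rw [le_div_iff₀ (by linarith)]
      linarith
    linarith
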